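/- **Setting.** Let $A\in\mathbb R^{n\times n}$, $B\in\mathbb R^{n\times d}$, let $M\in\mathbb R^{n\times n}$, $N\in\mathbb R^{d\times d}$ and $W\in\mathbb R^{n\times n}$ be symmetric positive definite, and let $\Sigma_0\in\mathbb R^{n\times n}$ be symmetric positive semidefinite. Let $K\in\mathbb R^{d\times n}$ be a stable policy, i.e. $\Gamma:=A-BK$ has spectral radius $\rho(\Gamma)<1$, and assume $\Gamma\neq 0$. Let $x_0\sim\mathcal N(0,\Sigma_0)$ and let $w_1,w_2,\dots$ be i.i.d. $\mathcal N(0,W)$, independent of $x_0$. The states evolve as $$x_{t+1}=Ax_t+Ba_t+w_{t+1},\qquad a_t=-Kx_t ,$$ with costs $c_t=x_t^\top Mx_t+a_t^\top Na_t$. Let $\Sigma_\pi$ be the steady-state covariance, i.e. the unique solution of $\Sigma_\pi=\Gamma\Sigma_\pi\Gamma^\top+W$. Let $G$ be the unique solution of $$G=\begin{pmatrix}A^\top\\B^\top\end{pmatrix}\begin{pmatrix}I&-K^\top\end{pmatrix}G\begin{pmatrix}I\\-K\end{pmatrix}\begin{pmatrix}A&B\end{pmatrix}+\begin{pmatrix}M&0\\0&N\end{pmatrix},$$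 and let $H=\begin{pmatrix}I&-K^\top\end{pmatrix}G\begin{pmatrix}I\\-K\end{pmatrix}$ be the value matrix of the policy. **Estimators.** Fix a starting time $s\ge 0$ and a length $\tau$, and let $\phi_t=\mathrm{vec}(x_tx_t^\top)$. Let $\Phi$ and $\Phi_+$ be the $\tau\times n^2$ matrices with rows $\phi_s,\dots,\phi_{s+\tau-1}$ and $\phi_{s+1},\dots,\phi_{s+\tau}$, let $\mathbf W$ be the $\tau\times n^2$ matrix all of whose rows are $\mathrm{vec}(W)$, and let $\mathbf c=(c_s,\dots,c_{s+\tau-1})^\top$. The LSTD estimator $\widehat H_{\rm LS}$ is given by $$\mathrm{vec}(\widehat H_{\rm LS})=\big(\Phi^\top(\Phi-\Phi_++\mathbf W)\big)^{\dagger}\Phi^\top\mathbf c ,$$ where $\dagger$ is the Moore–Penrose pseudo-inverse, and $\widehat H_{\rm pr}$ is the orthogonal projection of $\widehat H_{\rm LS}$, in the Frobenius norm, onto the closed convex set $\{X: X\succeq M\}$. **Claim.** There are absolute constants $C$ and $k\in\mathbb N$ such that for every system as above there is a threshold $\tau_0$, depending only on $(n,d,A,B,K,M,N,W,\Sigma_0)$,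 with the following property. For all $s\ge 0$, all $\delta\in(0,1)$ and all $\tau\ge\tau_0$, with probability at least $1-\delta$, $$\|H-\widehat H\|_F\;\le\;\frac{\|H\|^2}{\lambda_{\min}(M)^2}\;C\,\tau^{-1/2}\,\|W\widehat H\|_F\,\operatorname{tr}(\Sigma_0+\Sigma_\pi)\,\big\|(A-BK)(\Sigma_0+\Sigma_\pi)^{1/2}\big\|\,\log^k(\tau/\delta)$$ holds for $\widehat H=\widehat H_{\rm pr}$. If in addition $\tau\ge\tau_0\,(1+\log(1/\delta))^k$, then, with probability at least $1-\delta$, the same bound also holds for $\widehat H=\widehat H_{\rm LS}$. Here $\|\cdot\|$ is the spectral norm and $\|\cdot\|_F$ the Frobenius norm. -/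

import Mathlib

open MeasureTheory ProbabilityTheory Matrix
open scoped MatrixOrder

universe u

namespace LQ

noncomputable section

/-! ### Matrix preliminaries -/

/-- Frobenius norm. -/
def frobNorm {m n : Type*} [Fintype m] [Fintype n] (X : Matrix m n ℝ) : ℝ :=
  Real.sqrt (∑ i, ∑ j, X i j ^ 2)

/-- Spectral norm, the operator norm with respect to the Euclidean norm. -/
def opNorm {n : ℕ} (X : Matrix (Fin n) (Fin n) ℝ) : ℝ :=
  ‖Matrix.toEuclideanCLM (n := Fin n) (𝕜 := ℝ) X‖

/-- Smallest eigenvalue of a symmetric matrix. -/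
def lambdaMin {n : ℕ} (X : Matrix (Fin n) (Fin n) ℝ) : ℝ :=
  sInf (spectrum ℝ X)

/-- A real matrix is stable if its spectral radius, computed from its complex eigenvalues, is
less than one. -/
def IsStable {n : ℕ} (X : Matrix (Fin n) (Fin n) ℝ) : Prop :=
  spectralRadius ℂ (X.map (algebraMap ℝ ℂ)) < 1

/-- The four Penrose conditions: `P` is the Moore-Penrose pseudo-inverse of `X`. -/
structure IsPseudoInverse {m n : Type*} [Fintype m] [Fintype n]
    (X : Matrix m n ℝ) (P : Matrix n m ℝ) : Prop where
  mul_mul : X * P * X = X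
  mul_mul' : P * X * P = P
  symm_left : (X * P)ᵀ = X * P
  symm_right : (P * X)ᵀ = P * X

theorem exists_isPseudoInverse {m n : Type*} [Fintype m] [Fintype n] (X : Matrix m n ℝ) :
    ∃ P, IsPseudoInverse X P := by
  classical
  have hS : (Xᵀ * X).IsHermitian := by
    simp [Matrix.IsHermitian, Matrix.conjTranspose_eq_transpose_of_trivial]
  have key : ∃ T : Matrix n n ℝ, Tᵀ = T ∧ T * (Xᵀ * X) = (Xᵀ * X) * T ∧
      (Xᵀ * X) * T * (Xᵀ * X) = Xᵀ * X ∧ T * (Xᵀ * X) * T = T := by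
    obtain ⟨U, hU, D, hD⟩ : ∃ U : Matrix n n ℝ, Uᵀ * U = 1 ∧ ∃ D : n → ℝ,
        Xᵀ * X = U * Matrix.diagonal D * Uᵀ := by
      refine ⟨hS.eigenvectorUnitary, ?_, hS.eigenvalues, ?_⟩
      · have := (Matrix.mem_unitaryGroup_iff' (A := (hS.eigenvectorUnitary : Matrix n n ℝ))).1
          hS.eigenvectorUnitary.2
        simpa [Matrix.star_eq_conjTranspose, Matrix.conjTranspose_eq_transpose_of_trivial] using this
      · have := hS.spectral_theorem
        simpa [Unitary.conjStarAlgAut_apply, Matrix.star_eq_conjTranspose,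
          Matrix.conjTranspose_eq_transpose_of_trivial, Function.comp_def] using this
    have prod : ∀ a b : n → ℝ, (U * Matrix.diagonal a * Uᵀ) * (U * Matrix.diagonal b * Uᵀ)
        = U * Matrix.diagonal (fun i => a i * b i) * Uᵀ := by
      intro a b
      calc (U * Matrix.diagonal a * Uᵀ) * (U * Matrix.diagonal b * Uᵀ)
          = U * Matrix.diagonal a * (Uᵀ * U) * Matrix.diagonal b * Uᵀ := by
            simp only [Matrix.mul_assoc]
        _ = _ := by
            rw [hU, Matrix.mul_one, Matrix.mul_assoc U, Matrix.diagonal_mul_diagonal]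
    refine ⟨U * Matrix.diagonal (fun i => (D i)⁻¹) * Uᵀ, ?_, ?_, ?_, ?_⟩
    · simp [Matrix.transpose_mul, Matrix.mul_assoc]
    · rw [hD, prod, prod]; simp only [mul_comm]
    · rw [hD, prod, prod]
      congr 3; funext i
      by_cases h : D i = 0 <;> simp [h]
    · rw [hD, prod, prod]
      congr 3; funext i
      by_cases h : D i = 0 <;> simp [h]
  obtain ⟨T, hT, hc, h1, h2⟩ := key
  have hXT : X * (T * (Xᵀ * X)) = X := by
    have h0 : (X * (T * (Xᵀ * X)) - X)ᵀ * (X * (T * (Xᵀ * X)) - X) = 0 := by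
      have e1 : (X * (T * (Xᵀ * X)) - X)ᵀ = (Xᵀ * X) * T * Xᵀ - Xᵀ := by
        simp [Matrix.transpose_sub, Matrix.transpose_mul, hT, Matrix.mul_assoc]
      rw [e1, Matrix.sub_mul, Matrix.mul_sub, Matrix.mul_sub]
      have a1 : (Xᵀ * X) * T * Xᵀ * (X * (T * (Xᵀ * X))) = Xᵀ * X := by
        calc _ = ((Xᵀ * X) * T * (Xᵀ * X)) * T * (Xᵀ * X) := by simp only [Matrix.mul_assoc]
          _ = _ := by rw [h1, h1]
      have a2 : (Xᵀ * X) * T * Xᵀ * X = Xᵀ * X := by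
        calc _ = (Xᵀ * X) * T * (Xᵀ * X) := by simp only [Matrix.mul_assoc]
          _ = _ := h1
      have a3 : Xᵀ * (X * (T * (Xᵀ * X))) = Xᵀ * X := by
        calc _ = (Xᵀ * X) * T * (Xᵀ * X) := by simp only [Matrix.mul_assoc]
          _ = _ := h1
      rw [a1, a2, a3]; simp
    have h3 : (X * (T * (Xᵀ * X)) - X)ᴴ * (X * (T * (Xᵀ * X)) - X) = 0 := by
      rw [Matrix.conjTranspose_eq_transpose_of_trivial]; exact h0
    exact sub_eq_zero.1 (Matrix.conjTranspose_mul_self_eq_zero.1 h3)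
  refine ⟨T * Xᵀ, ?_, ?_, ?_, ?_⟩
  · calc X * (T * Xᵀ) * X = X * (T * (Xᵀ * X)) := by simp only [Matrix.mul_assoc]
      _ = X := hXT
  · calc T * Xᵀ * X * (T * Xᵀ) = (T * (Xᵀ * X) * T) * Xᵀ := by simp only [Matrix.mul_assoc]
      _ = T * Xᵀ := by rw [h2]
  · simp [Matrix.transpose_mul, hT, Matrix.mul_assoc]
  · have : T * Xᵀ * X = T * (Xᵀ * X) := Matrix.mul_assoc _ _ _
    rw [this, Matrix.transpose_mul, hT, Matrix.transpose_mul, Matrix.transpose_transpose, ← hc]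

/-- The Moore-Penrose pseudo-inverse. -/
def pinv {m n : Type*} [Fintype m] [Fintype n] (X : Matrix m n ℝ) : Matrix n m ℝ :=
  (exists_isPseudoInverse X).choose

/-- `P` is a point of `{P | P ⪰ M}` nearest to `X` in the Frobenius norm. -/
def IsNearestAbove {n : ℕ} (M X P : Matrix (Fin n) (Fin n) ℝ) : Prop :=
  (P - M).PosSemidef ∧
    ∀ Y : Matrix (Fin n) (Fin n) ℝ, (Y - M).PosSemidef → frobNorm (X - P) ≤ frobNorm (X - Y)

theorem exists_isNearestAbove {n : ℕ} (M X : Matrix (Fin n) (Fin n) ℝ) :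
    ∃ P, IsNearestAbove M X P := by
  let : NormedAddCommGroup (Matrix (Fin n) (Fin n) ℝ) := Matrix.frobeniusNormedAddCommGroup
  let : NormedSpace ℝ (Matrix (Fin n) (Fin n) ℝ) := Matrix.frobeniusNormedSpace
  have : ProperSpace (Matrix (Fin n) (Fin n) ℝ) := FiniteDimensional.proper ℝ _
  have hn : ∀ Y : Matrix (Fin n) (Fin n) ℝ, frobNorm Y = ‖Y‖ := by
    intro Y
    rw [Matrix.frobenius_norm_def, frobNorm, Real.sqrt_eq_rpow]
    simp
  have hset : {P : Matrix (Fin n) (Fin n) ℝ | (P - M).PosSemidef} =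
      {P | (P - M)ᵀ = P - M} ∩ ⋂ x : Fin n → ℝ, {P | 0 ≤ x ⬝ᵥ ((P - M) *ᵥ x)} := by
    ext P
    simp [Matrix.posSemidef_iff_dotProduct_mulVec, Matrix.IsHermitian,
      Matrix.conjTranspose_eq_transpose_of_trivial]
  have hc : IsClosed {P : Matrix (Fin n) (Fin n) ℝ | (P - M).PosSemidef} := by
    rw [hset]
    refine IsClosed.inter (isClosed_eq (by fun_prop) (by fun_prop))
      (isClosed_iInter fun x => isClosed_le (by fun_prop) (by fun_prop))
  obtain ⟨P, hP, h⟩ := hc.exists_infDist_eq_dist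
    ⟨M, by simpa using Matrix.PosSemidef.zero⟩ X
  refine ⟨P, hP, fun Y hY => ?_⟩
  rw [hn, hn, ← dist_eq_norm, ← dist_eq_norm, ← h]
  exact Metric.infDist_le_dist_of_mem hY

/-- Orthogonal (Frobenius) projection onto the closed convex set `{P | P ⪰ M}`. -/
def projAbove {n : ℕ} (M X : Matrix (Fin n) (Fin n) ℝ) : Matrix (Fin n) (Fin n) ℝ :=
  (exists_isNearestAbove M X).choose

/-! ### The linear quadratic system -/

/-- The linear policy `x ↦ -K x`. -/
def linPolicy {n d : ℕ} (K : Matrix (Fin d) (Fin n) ℝ) (x : Fin n → ℝ) : Fin d → ℝ :=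
  -(K *ᵥ x)

/-- The quadratic cost `xᵀ M x + aᵀ N a`. -/
def lqCost {n d : ℕ} (M : Matrix (Fin n) (Fin n) ℝ) (N : Matrix (Fin d) (Fin d) ℝ)
    (x : Fin n → ℝ) (a : Fin d → ℝ) : ℝ :=
  x ⬝ᵥ (M *ᵥ x) + a ⬝ᵥ (N *ᵥ a)

/-- The states `x 0, x 1, …` when the policy `x ↦ -K x` is followed from the initial state `x0`:
`x (t + 1) = A x t + B a t + w (t + 1)` with `a t = -K x t`. -/
def lqState {n d : ℕ} (A : Matrix (Fin n) (Fin n) ℝ) (B : Matrix (Fin n) (Fin d) ℝ)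
    (K : Matrix (Fin d) (Fin n) ℝ) (x0 : EuclideanSpace ℝ (Fin n))
    (w : ℕ → EuclideanSpace ℝ (Fin n)) : ℕ → Fin n → ℝ
  | 0 => x0.ofLp
  | t + 1 => A *ᵥ lqState A B K x0 w t + B *ᵥ linPolicy K (lqState A B K x0 w t)
      + (w (t + 1)).ofLp

/-- The block column `[I; -K]`, which maps a state `x` to the pair `(x, -K x)`. -/
def policyBlock {n d : ℕ} (K : Matrix (Fin d) (Fin n) ℝ) : Matrix (Fin n ⊕ Fin d) (Fin n) ℝ :=
  fromRows 1 (-K)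

/-- The block row `[A B]`. -/
def dynamicsBlock {n d : ℕ} (A : Matrix (Fin n) (Fin n) ℝ) (B : Matrix (Fin n) (Fin d) ℝ) :
    Matrix (Fin n) (Fin n ⊕ Fin d) ℝ :=
  fromCols A B

/-- `G` is the state-action value matrix of the policy `x ↦ -K x`. It solves the equation
`G = [A B]ᵀ [I; -K]ᵀ G [I; -K] [A B] + diag(M, N)`, whose solution is unique when `A - B K` is
stable. -/
def IsActionValueMatrix {n d : ℕ} (A : Matrix (Fin n) (Fin n) ℝ) (B : Matrix (Fin n) (Fin d) ℝ)
    (K : Matrix (Fin d) (Fin n) ℝ) (M : Matrix (Fin n) (Fin n) ℝ)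
    (N : Matrix (Fin d) (Fin d) ℝ) (G : Matrix (Fin n ⊕ Fin d) (Fin n ⊕ Fin d) ℝ) : Prop :=
  G = (dynamicsBlock A B)ᵀ * (policyBlock K)ᵀ * G * policyBlock K * dynamicsBlock A B
    + fromBlocks M 0 0 N

/-- The value matrix `H = [I; -K]ᵀ G [I; -K]`. -/
def valueMatrix {n d : ℕ} (K : Matrix (Fin d) (Fin n) ℝ)
    (G : Matrix (Fin n ⊕ Fin d) (Fin n ⊕ Fin d) ℝ) : Matrix (Fin n) (Fin n) ℝ :=
  (policyBlock K)ᵀ * G * policyBlock K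

/-- `S` is the steady-state covariance of `x (t + 1) = Γ x t + w (t + 1)` with noise covariance
`W`: it solves the Lyapunov equation, whose solution is unique when `Γ` is stable. -/
def IsSteadyStateCov {n : ℕ} (Γ W S : Matrix (Fin n) (Fin n) ℝ) : Prop :=
  S = Γ * S * Γᵀ + W

/-! ### The LSTD estimator -/

/-- The matrix whose rows are `vec (y t (y t)ᵀ)`, `t = 0, …, τ - 1`. -/
def featureMatrix {n : ℕ} (y : ℕ → Fin n → ℝ) (τ : ℕ) : Matrix (Fin τ) (Fin n × Fin n) ℝ :=
  Matrix.of fun t => vec (vecMulVec (y t) (y t))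

/-- The square matrix with a given vectorization. -/
def unvec {n : ℕ} (v : Fin n × Fin n → ℝ) : Matrix (Fin n) (Fin n) ℝ :=
  Matrix.of fun i j => v (j, i)

/-- The least squares temporal difference estimator
`vec Ĥ = (Φᵀ (Φ - Φ₊ + 𝐖))† Φᵀ c` computed from the `τ` transitions `y t → y (t + 1)`,
`t = 0, …, τ - 1`, of the policy `x ↦ -K x`. -/
def lstd {n d : ℕ} (K : Matrix (Fin d) (Fin n) ℝ) (M : Matrix (Fin n) (Fin n) ℝ)
    (N : Matrix (Fin d) (Fin d) ℝ) (W : Matrix (Fin n) (Fin n) ℝ)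
    (y : ℕ → Fin n → ℝ) (τ : ℕ) : Matrix (Fin n) (Fin n) ℝ :=
  let Φ : Matrix (Fin τ) (Fin n × Fin n) ℝ := featureMatrix y τ
  let Φp : Matrix (Fin τ) (Fin n × Fin n) ℝ := featureMatrix (fun t => y (t + 1)) τ
  let WW : Matrix (Fin τ) (Fin n × Fin n) ℝ := Matrix.of fun _ => vec W
  let c : Fin τ → ℝ := fun t => lqCost M N (y t) (linPolicy K (y t))
  unvec (pinv (Φᵀ * (Φ - Φp + WW)) *ᵥ (Φᵀ *ᵥ c))

/-- The LSTD estimator, projected onto the constraint `Ĥ ⪰ M`. -/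
def lstdProj {n d : ℕ} (K : Matrix (Fin d) (Fin n) ℝ) (M : Matrix (Fin n) (Fin n) ℝ)
    (N : Matrix (Fin d) (Fin d) ℝ) (W : Matrix (Fin n) (Fin n) ℝ)
    (y : ℕ → Fin n → ℝ) (τ : ℕ) : Matrix (Fin n) (Fin n) ℝ :=
  projAbove M (lstd K M N W y τ)

/-- The right-hand side of the error bound with the value matrix `H`, an estimate `Ĥ`, the
closed-loop matrix `Γ`, `SV = Σ_0 + Σ_π` and a logarithmic factor `L`:
`‖H‖² / λ_min(M)² * (L * τ^(-1/2) * ‖W Ĥ‖_F * tr SV * ‖Γ SV^(1/2)‖)`. -/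
def errorBound {n : ℕ} (M W H Hhat Γ SV : Matrix (Fin n) (Fin n) ℝ) (τ : ℕ) (L : ℝ) : ℝ :=
  opNorm H ^ 2 / lambdaMin M ^ 2 *
    (L * (τ : ℝ) ^ (-(1 / 2) : ℝ) * frobNorm (W * Hhat) * SV.trace *
      opNorm (Γ * CFC.sqrt SV))

end

end LQ

/-!
The value matrix `H` solves the Lyapunov equation `H = Γᵀ H Γ + M + Kᵀ N K` with `Γ = A - B K`, so
on a trajectory the costs satisfy `c = Φ (H - Γᵀ H Γ)`, while `Φ - Φ₊ + 𝐖` acts on a symmetric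
matrix `X` as `Φ (X - Γᵀ X Γ) - Ξ X`, where the entries of `Ξ` have conditional mean zero given the
current state. The LSTD estimator is therefore an instrumental variable regression: on symmetric
matrices its error is at most of order `‖Φᵀ Ξ‖ / λ_min(Φᵀ Φ)` (`vecNorm_regression_error_le`), since
`X ↦ X - Γᵀ X Γ` is invertible by stability.

Two facts about the trajectory remain, and both concern sums of martingale differences. The entries
of `Φᵀ Ξ` are such sums. The Gram matrix `Φᵀ Φ` dominates, up to such sums, a sum of conditional
second moments of the next features, weighted so that quartic functions of the noise are bounded.
Each of these is bounded below on symmetric matrices, because a quadratic polynomial vanishing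
almost surely under a nondegenerate Gaussian is zero (`exists_pos_le_integral_quadFeature`,
`gram_lower_bound`). No mixing of the states is needed.

The sums are of order `√τ log (τ / δ)^5` with probability `1 - δ` (`exists_deviation_bound`). The
differences at times when the current state is large are dropped; this condition does not involve
the next noise, so the mean zero property is kept, and the moment generating function at the scale
`1 / √τ` is bounded one step at a time. A logarithmic truncation level suffices because the states
have exponential moments bounded uniformly in time, as `Γ` is a contraction in an adapted norm.

Hence the LSTD error is at most a system constant times `τ^(-1/2) log (τ / δ)^5` as soon as
`log (τ / δ)^5` is small against `√τ` (`exists_lstd_bound`). The claim has five further powers of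
the logarithm, and since the threshold on `τ` may depend on the system, these absorb every constant,
including the lower bound for `‖W Ĥ‖_F` that holds because `Ĥ` is close to `H ≠ 0`. Projecting onto
`{X | X ⪰ M}` does not increase the distance to `H`. For the projected estimator no upper bound on
`log (1 / δ)` is required: if `log (τ / δ)^5` is large against `√τ`, then the claimed bound exceeds
`‖H‖_F + ‖Ĥ‖_F`, which is of order `‖W Ĥ‖_F` because `Ĥ ⪰ M`.
-/

namespace LQ

open Filter Topology

/-! ### Stable matrices -/

/-- The powers of a stable matrix tend to zero, by Gelfand's formula. -/
theorem IsStable.tendsto_pow {n : ℕ} {Γ : Matrix (Fin n) (Fin n) ℝ} (h : IsStable Γ) :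
    Tendsto (fun k => Γ ^ k) atTop (𝓝 0) := by
  let : NormedRing (Matrix (Fin n) (Fin n) ℂ) := Matrix.linftyOpNormedRing
  let : NormedAlgebra ℂ (Matrix (Fin n) (Fin n) ℂ) := Matrix.linftyOpNormedAlgebra
  have : CompleteSpace (Matrix (Fin n) (Fin n) ℂ) := FiniteDimensional.complete ℂ _
  set a : Matrix (Fin n) (Fin n) ℂ := Γ.map (algebraMap ℝ ℂ) with ha
  have hpow : ∀ k, a ^ k = (Γ ^ k).map (algebraMap ℝ ℂ) := fun k => by
    rw [ha]
    exact ((algebraMap ℝ ℂ).mapMatrix.map_pow Γ k).symm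
  obtain ⟨r, hr1, hr2⟩ := ENNReal.lt_iff_exists_nnreal_btwn.1 (show spectralRadius ℂ a < 1 from h)
  have hr2' : r < 1 := by exact_mod_cast hr2
  have ev : ∀ᶠ k : ℕ in atTop, ‖a ^ k‖ ≤ (r : ℝ) ^ k := by
    filter_upwards [(spectrum.pow_nnnorm_pow_one_div_tendsto_nhds_spectralRadius a).eventually_lt
      tendsto_const_nhds hr1, eventually_gt_atTop 0] with k hk hk0
    have hk0' : (0 : ℝ) < k := by exact_mod_cast hk0
    have h1 : (‖a ^ k‖₊ : ENNReal) ≤ (r : ENNReal) ^ (k : ℝ) := by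
      have := ENNReal.rpow_le_rpow hk.le hk0'.le
      rwa [← ENNReal.rpow_mul, one_div, inv_mul_cancel₀ hk0'.ne', ENNReal.rpow_one] at this
    rw [ENNReal.rpow_natCast] at h1
    exact_mod_cast h1
  have hn : Tendsto (fun k => ‖a ^ k‖) atTop (𝓝 0) :=
    squeeze_zero' (Eventually.of_forall fun _ => norm_nonneg _) ev
      (tendsto_pow_atTop_nhds_zero_of_lt_one r.2 (by exact_mod_cast hr2'))
  have hc : Tendsto (fun k => a ^ k) atTop (𝓝 0) := tendsto_zero_iff_norm_tendsto_zero.2 hn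
  refine tendsto_pi_nhds.2 fun i => tendsto_pi_nhds.2 fun j => ?_
  have h2 : Tendsto (fun k => (a ^ k) i j) atTop (𝓝 0) :=
    ((show Continuous fun Y : Matrix (Fin n) (Fin n) ℂ => Y i j by fun_prop).tendsto 0).comp hc
  have h3 := (Complex.continuous_re.tendsto 0).comp h2
  simpa [Function.comp_def, hpow] using h3

theorem IsStable.tendsto_transpose_pow {n : ℕ} {Γ : Matrix (Fin n) (Fin n) ℝ} (h : IsStable Γ) :
    Tendsto (fun k => Γᵀ ^ k) atTop (𝓝 0) := by
  have := ((continuous_id.matrix_transpose).tendsto (0 : Matrix (Fin n) (Fin n) ℝ)).comp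
    h.tendsto_pow
  simpa [Function.comp_def, Matrix.transpose_pow] using this

/-- If the powers of `T` tend to zero then the only solution of `X = Tᵀ X T` is zero. -/
theorem eq_zero_of_eq_conj {n : ℕ} {T X : Matrix (Fin n) (Fin n) ℝ}
    (hT : Tendsto (fun k => T ^ k) atTop (𝓝 0)) (hX : X = Tᵀ * X * T) : X = 0 := by
  have h1 : ∀ k : ℕ, X = (T ^ k)ᵀ * X * T ^ k := by
    intro k
    induction k with
    | zero => simp
    | succ k ih =>
      have : (T ^ (k + 1))ᵀ * X * T ^ (k + 1) = (T ^ k)ᵀ * (Tᵀ * X * T) * T ^ k := by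
        rw [pow_succ' T k]
        simp only [Matrix.transpose_mul, Matrix.mul_assoc]
      rw [this, ← hX, ← ih]
  have hc : Continuous fun Y : Matrix (Fin n) (Fin n) ℝ => Yᵀ * X * Y := by fun_prop
  have h2 := (hc.tendsto 0).comp hT
  simp only [Function.comp_def, ← h1, Matrix.mul_zero] at h2
  exact tendsto_nhds_unique tendsto_const_nhds h2

/-- The solution of `X = Tᵀ X T + Q` with `Q ⪰ 0` satisfies `X ⪰ Q`. -/
theorem posSemidef_sub_of_eq_conj_add {n : ℕ} {T X Q : Matrix (Fin n) (Fin n) ℝ}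
    (hT : Tendsto (fun k => T ^ k) atTop (𝓝 0)) (hQ : Q.PosSemidef) (hX : X = Tᵀ * X * T + Q) :
    (X - Q).PosSemidef := by
  have hQs : Qᵀ = Q := by
    simpa [Matrix.IsHermitian, Matrix.conjTranspose_eq_transpose_of_trivial] using hQ.1
  have hXs : Xᵀ = X := by
    have : Xᵀ - X = Tᵀ * (Xᵀ - X) * T := by
      conv_lhs => rw [hX]
      simp only [Matrix.transpose_add, Matrix.transpose_mul, Matrix.transpose_transpose, hQs,
        Matrix.mul_sub, Matrix.sub_mul, Matrix.mul_assoc]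
      abel
    exact sub_eq_zero.1 (eq_zero_of_eq_conj hT this)
  have hXq : ∀ x : Fin n → ℝ, x ⬝ᵥ (X *ᵥ x) = (T *ᵥ x) ⬝ᵥ (X *ᵥ (T *ᵥ x)) + x ⬝ᵥ (Q *ᵥ x) := by
    intro x
    conv_lhs => rw [hX]
    rw [Matrix.add_mulVec, dotProduct_add]
    congr 1
    rw [← Matrix.mulVec_mulVec, ← Matrix.mulVec_mulVec, Matrix.dotProduct_mulVec,
      Matrix.vecMul_transpose]
  have hQ0 : ∀ x : Fin n → ℝ, 0 ≤ x ⬝ᵥ (Q *ᵥ x) := fun x => by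
    simpa using hQ.dotProduct_mulVec_nonneg x
  have hnn : ∀ x : Fin n → ℝ, 0 ≤ x ⬝ᵥ (X *ᵥ x) := by
    intro x
    have hk : ∀ k : ℕ, (T ^ k *ᵥ x) ⬝ᵥ (X *ᵥ (T ^ k *ᵥ x)) ≤ x ⬝ᵥ (X *ᵥ x) := by
      intro k
      induction k with
      | zero => simp
      | succ k ih =>
        refine le_trans ?_ ih
        rw [hXq (T ^ k *ᵥ x), pow_succ', ← Matrix.mulVec_mulVec]
        linarith [hQ0 (T ^ k *ᵥ x)]
    have hc : Continuous fun Y : Matrix (Fin n) (Fin n) ℝ => (Y *ᵥ x) ⬝ᵥ (X *ᵥ (Y *ᵥ x)) := by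
      fun_prop
    have h2 := (hc.tendsto 0).comp hT
    simp only [Function.comp_def, Matrix.zero_mulVec, zero_dotProduct] at h2
    exact le_of_tendsto' h2 hk
  rw [Matrix.posSemidef_iff_dotProduct_mulVec]
  refine ⟨?_, fun x => ?_⟩
  · simp [Matrix.IsHermitian, Matrix.conjTranspose_eq_transpose_of_trivial, hXs, hQs]
  · have := hnn (T *ᵥ x)
    simp only [star_trivial, Matrix.sub_mulVec, dotProduct_sub]
    linarith [hXq x]

/-- An adapted norm of a matrix whose powers tend to zero: the matrix is a strict contraction for
the norm `N`, which is equivalent to the supremum norm. -/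
theorem exists_adapted_norm {n : ℕ} {Γ : Matrix (Fin n) (Fin n) ℝ}
    (h : Tendsto (fun k => Γ ^ k) atTop (𝓝 0)) :
    ∃ (N : (Fin n → ℝ) → ℝ) (r C : ℝ), 0 < r ∧ r < 1 ∧ 0 ≤ C ∧ Continuous N ∧
      (∀ x, N (Γ *ᵥ x) ≤ r * N x) ∧ (∀ x y, N (x + y) ≤ N x + N y) ∧
      (∀ x, ‖x‖ ≤ N x) ∧ ∀ x, N x ≤ C * ‖x‖ := by
  let : NormedRing (Matrix (Fin n) (Fin n) ℝ) := Matrix.linftyOpNormedRing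
  have hmv : ∀ (Y : Matrix (Fin n) (Fin n) ℝ) (x : Fin n → ℝ), ‖Y *ᵥ x‖ ≤ ‖Y‖ * ‖x‖ :=
    fun Y x => Matrix.linfty_opNorm_mulVec Y x
  have h0 : Tendsto (fun k => ‖Γ ^ k‖) atTop (𝓝 0) := tendsto_zero_iff_norm_tendsto_zero.1 h
  obtain ⟨m, hm, hm0⟩ := ((h0.eventually_lt_const (show (0 : ℝ) < 1 / 2 by norm_num)).and
    (eventually_gt_atTop 0)).exists
  -- the weight `a` with `a ^ m = 2` makes the telescoping below contract
  set a : ℝ := (2 : ℝ) ^ ((m : ℝ)⁻¹) with ha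
  have ham : a ^ m = 2 := Real.rpow_inv_natCast_pow (by norm_num) hm0.ne'
  have ha1 : 1 < a := Real.one_lt_rpow (by norm_num) (by positivity)
  have ha0 : 0 < a := by linarith
  refine ⟨fun x => ∑ j ∈ Finset.range m, a ^ j * ‖Γ ^ j *ᵥ x‖, a⁻¹,
    ∑ j ∈ Finset.range m, a ^ j * ‖Γ ^ j‖, by positivity, inv_lt_one_of_one_lt₀ ha1,
    by positivity, by fun_prop, fun x => ?_, fun x y => ?_, fun x => ?_, fun x => ?_⟩
  · rw [inv_mul_eq_div, le_div_iff₀ ha0]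
    have e1 : (∑ j ∈ Finset.range m, a ^ j * ‖Γ ^ j *ᵥ (Γ *ᵥ x)‖) * a
        = ∑ j ∈ Finset.range m, a ^ (j + 1) * ‖Γ ^ (j + 1) *ᵥ x‖ := by
      rw [Finset.sum_mul]
      refine Finset.sum_congr rfl fun j _ => ?_
      rw [Matrix.mulVec_mulVec, ← pow_succ]
      ring
    have e2 := Finset.sum_range_succ' (fun j => a ^ j * ‖Γ ^ j *ᵥ x‖) m
    have e3 := Finset.sum_range_succ (fun j => a ^ j * ‖Γ ^ j *ᵥ x‖) m
    have e4 : a ^ m * ‖Γ ^ m *ᵥ x‖ ≤ ‖x‖ := by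
      rw [ham]
      have := hmv (Γ ^ m) x
      nlinarith [norm_nonneg x]
    simp only [pow_zero, Matrix.one_mulVec, one_mul] at e2
    rw [e1]
    linarith
  · rw [← Finset.sum_add_distrib]
    refine Finset.sum_le_sum fun j _ => ?_
    rw [← mul_add, Matrix.mulVec_add]
    gcongr
    exact norm_add_le _ _
  · have := Finset.single_le_sum (f := fun j => a ^ j * ‖Γ ^ j *ᵥ x‖) (s := Finset.range m)
      (fun j _ => by positivity) (Finset.mem_range.2 hm0)
    simpa using this
  · rw [Finset.sum_mul]
    refine Finset.sum_le_sum fun j _ => ?_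
    rw [mul_assoc]
    gcongr
    exact hmv _ _

/-! ### The pseudo-inverse -/

theorem pinv_spec {m n : Type*} [Fintype m] [Fintype n] (X : Matrix m n ℝ) :
    IsPseudoInverse X (pinv X) := (exists_isPseudoInverse X).choose_spec

/-- Suppose that the subspace `V` contains `v` and the row space of `X`, and meets the kernel of `X`
trivially. Then `X† X` fixes `v`, hence `X†` recovers `v` from `X v + e` up to `X† e`, and the image
of this error under `X` is an orthogonal projection of `e`. -/
theorem pinv_mulVec_error {m n : Type*} [Fintype m] [Fintype n] (X : Matrix m n ℝ)
    (V : Submodule ℝ (n → ℝ)) (hrow : ∀ u, Xᵀ *ᵥ u ∈ V) (hinj : ∀ v ∈ V, X *ᵥ v = 0 → v = 0)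
    (v : n → ℝ) (hv : v ∈ V) (e : m → ℝ) :
    (pinv X *ᵥ (X *ᵥ v + e) - v) ∈ V ∧
      (X *ᵥ (pinv X *ᵥ (X *ᵥ v + e) - v)) ⬝ᵥ (X *ᵥ (pinv X *ᵥ (X *ᵥ v + e) - v)) ≤ e ⬝ᵥ e := by
  classical
  obtain ⟨h1, h2, h3, h4⟩ := pinv_spec X
  set P := pinv X
  have hPr : ∀ u, P *ᵥ u ∈ V := by
    intro u
    have : P *ᵥ u = Xᵀ *ᵥ (Pᵀ *ᵥ (P *ᵥ u)) := by
      rw [Matrix.mulVec_mulVec, Matrix.mulVec_mulVec, ← Matrix.transpose_mul, h4, h2]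
    rw [this]
    exact hrow _
  have hfix : P *ᵥ (X *ᵥ v) = v := by
    refine sub_eq_zero.1 (hinj _ (V.sub_mem (hPr _) hv) ?_)
    rw [Matrix.mulVec_sub, Matrix.mulVec_mulVec, Matrix.mulVec_mulVec, h1, sub_self]
  have hΔ : P *ᵥ (X *ᵥ v + e) - v = P *ᵥ e := by
    rw [Matrix.mulVec_add, hfix, add_sub_cancel_left]
  rw [hΔ]
  refine ⟨hPr _, ?_⟩
  have hR : (X * P) * (X * P) = X * P := by rw [← Matrix.mul_assoc, h1]
  rw [Matrix.mulVec_mulVec]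
  set R := X * P
  have e1 : (R *ᵥ e) ⬝ᵥ (R *ᵥ e) = e ⬝ᵥ (R *ᵥ e) := by
    conv_lhs => rw [Matrix.dotProduct_mulVec, Matrix.vecMul_mulVec, h3, hR, dotProduct_comm,
      ← Matrix.mulVec_transpose, h3]
  have e2 : 0 ≤ (e - R *ᵥ e) ⬝ᵥ (e - R *ᵥ e) :=
    Finset.sum_nonneg fun i _ => mul_self_nonneg _
  simp only [sub_dotProduct, dotProduct_sub, e1] at e2
  rw [dotProduct_comm (R *ᵥ e) e] at e2
  linarith

/-! ### Exponential moments of sums of martingale differences -/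

theorem exp_le_one_add_self_add_sq_mul_exp_abs (u : ℝ) :
    Real.exp u ≤ 1 + u + u ^ 2 * Real.exp |u| := by
  rcases le_or_gt |u| 1 with h | h
  · have h1 := (abs_le.1 (Real.abs_exp_sub_one_sub_id_le h)).2
    have h2 : u ^ 2 * 1 ≤ u ^ 2 * Real.exp |u| :=
      mul_le_mul_of_nonneg_left (Real.one_le_exp (abs_nonneg u)) (sq_nonneg u)
    linarith
  · have hsq : 1 * |u| ≤ u ^ 2 := by
      rw [← sq_abs]
      nlinarith
    have h2 : u ^ 2 * 1 ≤ u ^ 2 * Real.exp |u| :=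
      mul_le_mul_of_nonneg_left (Real.one_le_exp (abs_nonneg u)) (sq_nonneg u)
    rcases le_total 0 u with h0 | h0
    · rw [abs_of_nonneg h0] at *
      nlinarith [Real.exp_pos u]
    · have := Real.exp_le_one_iff.2 h0
      rw [abs_of_nonpos h0] at *
      linarith

/-- The moment generating function of a centred variable with an exponentially integrable
majorant is bounded by that of a Gaussian near the origin. -/
theorem lintegral_exp_mul_le {β : Type*} [MeasurableSpace β] (ν : Measure β)
    [IsProbabilityMeasure ν] {f g : β → ℝ} (hf : Measurable f) (hfg : ∀ z, |f z| ≤ g z)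
    (hg : Integrable (fun z => Real.exp (2 * g z)) ν) (hf0 : ∫ z, f z ∂ν = 0) {l : ℝ}
    (hl0 : 0 ≤ l) (hl1 : l ≤ 1) :
    ∫⁻ z, ENNReal.ofReal (Real.exp (l * f z)) ∂ν
      ≤ ENNReal.ofReal (Real.exp (l ^ 2 * (2 * ∫ z, Real.exp (2 * g z) ∂ν))) := by
  have hg0 : ∀ z, 0 ≤ g z := fun z => (abs_nonneg _).trans (hfg z)
  have hfi : Integrable f ν := by
    refine hg.mono' hf.aestronglyMeasurable (Eventually.of_forall fun z => ?_)
    have := Real.add_one_le_exp (2 * g z)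
    rw [Real.norm_eq_abs]
    linarith [hfg z, hg0 z]
  have hexp : Integrable (fun z => Real.exp (l * f z)) ν := by
    refine hg.mono' (by fun_prop) (Eventually.of_forall fun z => ?_)
    rw [Real.norm_eq_abs, abs_of_pos (Real.exp_pos _)]
    refine Real.exp_le_exp.2 ?_
    nlinarith [hfg z, hg0 z, le_abs_self (f z), abs_nonneg (f z)]
  have hpt : ∀ z, Real.exp (l * f z) ≤ 1 + l * f z + l ^ 2 * (2 * Real.exp (2 * g z)) := by
    intro z
    refine (exp_le_one_add_self_add_sq_mul_exp_abs _).trans ?_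
    have h1 : |l * f z| ≤ g z := by
      rw [abs_mul, abs_of_nonneg hl0]
      nlinarith [hfg z, abs_nonneg (f z)]
    have h2 : f z ^ 2 ≤ 2 * Real.exp (g z) := by
      have := Real.quadratic_le_exp_of_nonneg (hg0 z)
      have h3 : f z ^ 2 ≤ g z ^ 2 := sq_le_sq' (by linarith [abs_le.1 (hfg z)])
        (abs_le.1 (hfg z)).2
      nlinarith [hg0 z]
    have h4 : (l * f z) ^ 2 * Real.exp |l * f z| ≤ l ^ 2 * (2 * Real.exp (2 * g z)) := by
      calc (l * f z) ^ 2 * Real.exp |l * f z| ≤ l ^ 2 * (2 * Real.exp (g z)) * Real.exp (g z) := by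
            rw [mul_pow]
            gcongr
        _ = _ := by rw [two_mul (g z), Real.exp_add]; ring
    linarith
  rw [← ofReal_integral_eq_lintegral_ofReal hexp
    (Eventually.of_forall fun z => (Real.exp_pos _).le)]
  refine ENNReal.ofReal_le_ofReal ?_
  calc ∫ z, Real.exp (l * f z) ∂ν
      ≤ ∫ z, (1 + l * f z + l ^ 2 * (2 * Real.exp (2 * g z))) ∂ν :=
        integral_mono hexp (((integrable_const _).add (hfi.const_mul _)).add
          ((hg.const_mul _).const_mul _)) hpt
    _ = 1 + l ^ 2 * (2 * ∫ z, Real.exp (2 * g z) ∂ν) := by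
        have h1 : Integrable (fun z => 1 + l * f z) ν := (integrable_const _).add (hfi.const_mul _)
        rw [integral_add h1 ((hg.const_mul _).const_mul _),
          integral_add (integrable_const _) (hfi.const_mul _),
          integral_const_mul, hf0, integral_const_mul, integral_const_mul]
        simp
    _ ≤ _ := by linarith [Real.add_one_le_exp (l ^ 2 * (2 * ∫ z, Real.exp (2 * g z) ∂ν))]

/-- At every time `k` the innovation `Z k` is independent of the present state `X k` and of all
earlier states and innovations. -/
def PastIndep {Ω α β : Type*} [MeasurableSpace Ω] [MeasurableSpace α] [MeasurableSpace β]
    (X : ℕ → Ω → α) (Z : ℕ → Ω → β) (P : Measure Ω) : Prop :=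
  ∀ k, IndepFun (fun ω => (X k ω, fun t : Fin k => (X t ω, Z t ω))) (Z k) P

theorem measure_le_of_lintegral_exp_le {Ω : Type*} [MeasurableSpace Ω] {P : Measure Ω}
    {S : Ω → ℝ} (hS : Measurable S) {b : ℝ}
    (h : ∫⁻ ω, ENNReal.ofReal (Real.exp (S ω)) ∂P ≤ ENNReal.ofReal b) (u : ℝ) :
    P {ω | u ≤ S ω} ≤ ENNReal.ofReal (b * Real.exp (-u)) := by
  have h1 := meas_ge_le_lintegral_div (μ := P) (f := fun ω => ENNReal.ofReal (Real.exp (S ω)))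
    (by fun_prop) (ε := ENNReal.ofReal (Real.exp u)) (by simp [Real.exp_pos]) (by simp)
  have h2 : {ω | u ≤ S ω} =
      {ω | ENNReal.ofReal (Real.exp u) ≤ ENNReal.ofReal (Real.exp (S ω))} := by
    ext ω
    simp [ENNReal.ofReal_le_ofReal_iff (Real.exp_pos _).le]
  rw [h2]
  refine h1.trans ((ENNReal.div_le_div_right h _).trans ?_)
  rw [← ENNReal.ofReal_div_of_pos (Real.exp_pos _), Real.exp_neg, div_eq_mul_inv]

section Martingale

variable {Ω α β : Type*} [MeasurableSpace Ω] [MeasurableSpace α] [MeasurableSpace β]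
  {P : Measure Ω} [IsProbabilityMeasure P] {ν : Measure β} [IsProbabilityMeasure ν]
  {X : ℕ → Ω → α} {Z : ℕ → Ω → β}

theorem lintegral_exp_sum_le (hX : ∀ k, Measurable (X k)) (hZ : ∀ k, Measurable (Z k))
    (hlaw : ∀ k, P.map (Z k) = ν) (hind : PastIndep X Z P) {f : α → β → ℝ}
    (hf : Measurable (Function.uncurry f)) {a : ℝ}
    (ha : ∀ x, ∫⁻ z, ENNReal.ofReal (Real.exp (f x z)) ∂ν ≤ ENNReal.ofReal (Real.exp a)) (k : ℕ) :
    ∫⁻ ω, ENNReal.ofReal (Real.exp (∑ t ∈ Finset.range k, f (X t ω) (Z t ω))) ∂P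
      ≤ ENNReal.ofReal (Real.exp (k * a)) := by
  induction k with
  | zero => simp
  | succ k ih =>
    set S : Ω → ℝ := fun ω => ∑ t ∈ Finset.range k, f (X t ω) (Z t ω) with hS
    have hSm : Measurable S :=
      Finset.measurable_sum _ fun t _ => hf.comp ((hX t).prodMk (hZ t))
    have hi : IndepFun (fun ω => (X k ω, S ω)) (Z k) P := by
      have hφ : Measurable fun p : α × (Fin k → α × β) =>
          (p.1, ∑ t : Fin k, f (p.2 t).1 (p.2 t).2) := by
        refine measurable_fst.prodMk (Finset.measurable_sum _ fun t _ =>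
          hf.comp (Measurable.prodMk ?_ ?_))
        · exact measurable_fst.comp ((measurable_pi_apply t).comp measurable_snd)
        · exact measurable_snd.comp ((measurable_pi_apply t).comp measurable_snd)
      have := (hind k).comp hφ measurable_id
      have e : (fun ω => (X k ω, S ω)) = (fun p : α × (Fin k → α × β) =>
          (p.1, ∑ t : Fin k, f (p.2 t).1 (p.2 t).2)) ∘
            fun ω => (X k ω, fun t : Fin k => (X t ω, Z t ω)) := by
        funext ω
        simp [hS, Finset.sum_range]
      rw [e]
      exact this
    have hmap := hi.map_prod_eq_prod_map_map ((hX k).prodMk hSm).aemeasurable (hZ k).aemeasurable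
    rw [hlaw] at hmap
    set h : (α × ℝ) × β → ENNReal :=
      fun p => ENNReal.ofReal (Real.exp (p.1.2 + f p.1.1 p.2)) with hh
    have hhm : Measurable h := by
      refine ENNReal.measurable_ofReal.comp (Real.measurable_exp.comp
        (Measurable.add (by fun_prop) (hf.comp (Measurable.prodMk ?_ ?_)))) <;> fun_prop
    calc ∫⁻ ω, ENNReal.ofReal (Real.exp (∑ t ∈ Finset.range (k + 1), f (X t ω) (Z t ω))) ∂P
        = ∫⁻ ω, h ((X k ω, S ω), Z k ω) ∂P := by
          refine lintegral_congr fun ω => ?_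
          rw [Finset.sum_range_succ]
      _ = ∫⁻ p, h p ∂(P.map fun ω => ((X k ω, S ω), Z k ω)) :=
          (lintegral_map hhm (((hX k).prodMk hSm).prodMk (hZ k))).symm
      _ = ∫⁻ p, ∫⁻ z, h (p, z) ∂ν ∂(P.map fun ω => (X k ω, S ω)) := by
          rw [hmap, lintegral_prod _ hhm.aemeasurable]
      _ ≤ ∫⁻ p, ENNReal.ofReal (Real.exp p.2) * ENNReal.ofReal (Real.exp a)
            ∂(P.map fun ω => (X k ω, S ω)) := by
          refine lintegral_mono fun p => ?_
          simp only [hh, Real.exp_add, ENNReal.ofReal_mul (Real.exp_pos _).le]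
          have hm : Measurable fun z => ENNReal.ofReal (Real.exp (f p.1 z)) :=
            ENNReal.measurable_ofReal.comp (Real.measurable_exp.comp
              (hf.comp measurable_prodMk_left))
          rw [lintegral_const_mul _ hm]
          gcongr
          exact ha p.1
      _ = (∫⁻ ω, ENNReal.ofReal (Real.exp (S ω)) ∂P) * ENNReal.ofReal (Real.exp a) := by
          rw [lintegral_mul_const _ (by fun_prop), lintegral_map (by fun_prop) ((hX k).prodMk hSm)]
      _ ≤ ENNReal.ofReal (Real.exp (k * a)) * ENNReal.ofReal (Real.exp a) := by gcongr
      _ = ENNReal.ofReal (Real.exp ((k + 1 : ℕ) * a)) := by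
          rw [← ENNReal.ofReal_mul (Real.exp_pos _).le, ← Real.exp_add]
          congr 2
          push_cast
          ring

/-- A one-sided deviation bound for the sum of the differences `F (X t) (Z t)` over the times at
which the predictable truncation `N (X t) ≤ R` is in force. -/
theorem measure_truncated_sum_ge_le (hX : ∀ k, Measurable (X k)) (hZ : ∀ k, Measurable (Z k))
    (hlaw : ∀ k, P.map (Z k) = ν) (hind : PastIndep X Z P) {N : α → ℝ} (hN : Measurable N)
    (hN0 : ∀ x, 0 ≤ N x) {F : α → β → ℝ} (hF : Measurable (Function.uncurry F))
    (hF0 : ∀ x, ∫ z, F x z ∂ν = 0) {g : β → ℝ} (hg0 : ∀ z, 0 ≤ g z)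
    (hFg : ∀ x z, |F x z| ≤ (1 + N x) ^ 4 * g z)
    {θ : ℝ} (hθ : 0 < θ) (hg : Integrable (fun z => Real.exp (2 * (θ * g z))) ν) {R : ℝ}
    (hR : 0 ≤ R) {k : ℕ} (hk : 0 < k) (u : ℝ) :
    P {ω | θ⁻¹ * (1 + R) ^ 4 * √k * u
        ≤ ∑ t ∈ Finset.range k, if N (X t ω) ≤ R then F (X t ω) (Z t ω) else 0}
      ≤ ENNReal.ofReal (Real.exp (2 * ∫ z, Real.exp (2 * (θ * g z)) ∂ν) * Real.exp (-u)) := by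
  have hk0 : (0 : ℝ) < k := by exact_mod_cast hk
  have hsk : 0 < √(k : ℝ) := Real.sqrt_pos.2 hk0
  have hRp : 0 < (1 + R) ^ 4 := by positivity
  set f : α → β → ℝ := fun x z => θ / (1 + R) ^ 4 * if N x ≤ R then F x z else 0 with hfdef
  have hf : Measurable (Function.uncurry f) := by
    refine Measurable.const_mul ?_ _
    exact Measurable.ite (measurableSet_le (hN.comp measurable_fst) measurable_const) hF
      measurable_const
  have hfg : ∀ x z, |f x z| ≤ θ * g z := by
    intro x z
    simp only [hfdef]
    split_ifs with h
    · rw [abs_mul, abs_of_pos (by positivity), div_mul_eq_mul_div, div_le_iff₀ hRp]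
      have : |F x z| ≤ (1 + R) ^ 4 * g z := by
        refine (hFg x z).trans ?_
        have := hg0 z
        have := hN0 x
        gcongr
      nlinarith
    · simpa using mul_nonneg hθ.le (hg0 z)
  have hf0 : ∀ x, ∫ z, f x z ∂ν = 0 := by
    intro x
    simp only [hfdef]
    rw [integral_const_mul]
    split_ifs with h
    · rw [hF0, mul_zero]
    · simp
  -- at this scale the `k` factors `exp (l ^ 2 * c)` multiply to `exp c`
  set l : ℝ := (√(k : ℝ))⁻¹ with hl
  have hl0 : 0 ≤ l := by positivity
  have hl1 : l ≤ 1 := inv_le_one_of_one_le₀ (Real.one_le_sqrt.2 (by exact_mod_cast hk))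
  set c : ℝ := 2 * ∫ z, Real.exp (2 * (θ * g z)) ∂ν with hc
  have hmgf : ∀ x, ∫⁻ z, ENNReal.ofReal (Real.exp (l * f x z)) ∂ν
      ≤ ENNReal.ofReal (Real.exp (l ^ 2 * c)) := fun x =>
    lintegral_exp_mul_le ν (hf.comp measurable_prodMk_left) (hfg x) hg (hf0 x) hl0 hl1
  have hsum := lintegral_exp_sum_le hX hZ hlaw hind (f := fun x z => l * f x z)
    (hf.const_mul l) hmgf k
  have hlk : (k : ℝ) * (l ^ 2 * c) = c := by
    rw [hl, inv_pow, Real.sq_sqrt hk0.le]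
    field_simp
  rw [hlk] at hsum
  have hm : Measurable fun ω => ∑ t ∈ Finset.range k, l * f (X t ω) (Z t ω) :=
    Finset.measurable_sum _ fun t _ => (hf.comp ((hX t).prodMk (hZ t))).const_mul l
  refine le_trans (measure_mono fun ω hω => ?_)
    (measure_le_of_lintegral_exp_le hm hsum u)
  simp only [Set.mem_ofPred_eq] at hω ⊢
  rw [← Finset.mul_sum]
  simp only [hfdef]
  rw [← Finset.mul_sum, hl, ← div_eq_inv_mul, le_div_iff₀ hsk, div_mul_eq_mul_div,
    le_div_iff₀ hRp]
  have := mul_le_mul_of_nonneg_left hω hθ.le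
  calc u * √(k : ℝ) * (1 + R) ^ 4 = θ * (θ⁻¹ * (1 + R) ^ 4 * √k * u) := by
        field_simp
    _ ≤ _ := this

end Martingale

/-- Sums of finitely many kinds of martingale differences `F i (X t) (Z t)`, of growth at most
quartic in the state and with an exponentially integrable majorant in the innovation, are of order
`√k` up to logarithms. The constant depends on the noise law, on `F` and on the exponential moments
of the states, but not on the probability space. The states are truncated at `R ∼ log (k / δ)`. -/
theorem exists_deviation_bound {α β ι : Type*} [MeasurableSpace α] [MeasurableSpace β] [Fintype ι]
    (ν : Measure β) [IsProbabilityMeasure ν] {N : α → ℝ} (hN : Measurable N) (hN0 : ∀ x, 0 ≤ N x)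
    {F : ι → α → β → ℝ} (hF : ∀ i, Measurable (Function.uncurry (F i)))
    (hF0 : ∀ i x, ∫ z, F i x z ∂ν = 0) {g : β → ℝ} (hg0 : ∀ z, 0 ≤ g z)
    (hFg : ∀ i x z, |F i x z| ≤ (1 + N x) ^ 4 * g z) {θ : ℝ} (hθ : 0 < θ)
    (hg : Integrable (fun z => Real.exp (2 * (θ * g z))) ν) {C : ℝ} (hC : 1 ≤ C) :
    ∃ D : ℝ, 0 < D ∧ ∀ (Ω : Type u) [MeasurableSpace Ω] (P : Measure Ω) [IsProbabilityMeasure P]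
      (X : ℕ → Ω → α) (Z : ℕ → Ω → β), (∀ k, Measurable (X k)) → (∀ k, Measurable (Z k)) →
      (∀ k, P.map (Z k) = ν) → PastIndep X Z P →
      (∀ k, ∫⁻ ω, ENNReal.ofReal (Real.exp (N (X k ω))) ∂P ≤ ENNReal.ofReal C) →
      ∀ (k : ℕ) (δ : ℝ), 3 ≤ k → 0 < δ → δ < 1 → ∃ E : Set Ω, MeasurableSet E ∧ 1 - δ ≤ P.real E ∧
        ∀ ω ∈ E, ∀ i, |∑ t ∈ Finset.range k, F i (X t ω) (Z t ω)|
          ≤ D * √k * Real.log (k / δ) ^ 5 := by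
  set c : ℝ := 2 * ∫ z, Real.exp (2 * (θ * g z)) ∂ν with hc
  have hc0 : 0 ≤ c := mul_nonneg two_pos.le (integral_nonneg fun z => (Real.exp_pos _).le)
  set m : ℕ := Fintype.card ι with hm
  have hlogC : 0 ≤ Real.log (2 * C) := Real.log_nonneg (by linarith)
  have hlogm : 0 ≤ Real.log (4 * (m + 1)) :=
    Real.log_nonneg (by nlinarith [Nat.cast_nonneg (α := ℝ) m])
  refine ⟨θ⁻¹ * (2 + Real.log (2 * C)) ^ 4 * (c + Real.log (4 * (m + 1)) + 1), by positivity, ?_⟩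
  intro Ω _ P _ X Z hX hZ hlaw hind hmom k δ hk hδ0 hδ1
  have hk3 : (3 : ℝ) ≤ k := by exact_mod_cast hk
  have hk0 : (0 : ℝ) < k := by linarith
  set L : ℝ := Real.log (k / δ) with hL
  have hLk : Real.log k - Real.log δ = L := (Real.log_div hk0.ne' hδ0.ne').symm
  have hlogk : 1 ≤ Real.log k := by
    rw [Real.le_log_iff_exp_le hk0]
    linarith [Real.exp_one_lt_d9]
  have hlogδ : Real.log δ ≤ 0 := Real.log_nonpos hδ0.le hδ1.le
  have hL1 : 1 ≤ L := by linarith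
  -- with `R` some state is truncated with probability at most `δ / 2`, and with `u` each of the
  -- `2 m` one-sided deviations has probability at most `δ / (4 (m + 1))`
  set R : ℝ := Real.log (2 * C) + L with hR
  set u : ℝ := c + Real.log (4 * (m + 1)) - Real.log δ with hu
  have hexpR : Real.exp (-R) = δ / (2 * C * k) := by
    rw [hR, ← hLk, Real.exp_neg, Real.exp_add, Real.exp_sub, Real.exp_log (by linarith),
      Real.exp_log hk0, Real.exp_log hδ0]
    field_simp
  have hexpu : Real.exp c * Real.exp (-u) = δ / (4 * (m + 1)) := by
    rw [← Real.exp_add, show c + -u = Real.log δ - Real.log (4 * (m + 1)) by rw [hu]; ring,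
      Real.exp_sub, Real.exp_log hδ0, Real.exp_log (by positivity)]
  set T : ℝ := θ⁻¹ * (1 + R) ^ 4 * √k * u with hT
  set S : ι → Ω → ℝ := fun i ω =>
    ∑ t ∈ Finset.range k, if N (X t ω) ≤ R then F i (X t ω) (Z t ω) else 0 with hS
  have hSm : ∀ i, Measurable (S i) := fun i => Finset.measurable_sum _ fun t _ =>
    Measurable.ite (measurableSet_le (hN.comp (hX t)) measurable_const)
      ((hF i).comp ((hX t).prodMk (hZ t))) measurable_const
  set B1 : ℕ → Set Ω := fun t => {ω | R ≤ N (X t ω)} with hB1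
  set B2 : ι → Set Ω := fun i => {ω | T ≤ S i ω} with hB2
  set B3 : ι → Set Ω := fun i => {ω | T ≤ -S i ω} with hB3
  have hB1m : ∀ t, MeasurableSet (B1 t) := fun t =>
    measurableSet_le measurable_const (hN.comp (hX t))
  have hB2m : ∀ i, MeasurableSet (B2 i) := fun i => measurableSet_le measurable_const (hSm i)
  have hB3m : ∀ i, MeasurableSet (B3 i) := fun i => measurableSet_le measurable_const (hSm i).neg
  have hP1 : ∀ t, P.real (B1 t) ≤ δ / (2 * k) := by
    intro t
    refine ENNReal.toReal_le_of_le_ofReal (by positivity) ?_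
    refine (measure_le_of_lintegral_exp_le (hN.comp (hX t)) (hmom t) R).trans_eq ?_
    rw [hexpR]
    congr 1
    field_simp
  have hP2 : ∀ i, P.real (B2 i) ≤ δ / (4 * (m + 1)) := by
    intro i
    refine ENNReal.toReal_le_of_le_ofReal (by positivity) ?_
    rw [← hexpu]
    exact measure_truncated_sum_ge_le hX hZ hlaw hind hN hN0 (hF i) (hF0 i) hg0 (hFg i) hθ hg
      (by positivity) (by omega) u
  have hP3 : ∀ i, P.real (B3 i) ≤ δ / (4 * (m + 1)) := by
    intro i
    refine ENNReal.toReal_le_of_le_ofReal (by positivity) ?_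
    rw [← hexpu]
    have e : B3 i = {ω | T ≤ ∑ t ∈ Finset.range k,
        if N (X t ω) ≤ R then -F i (X t ω) (Z t ω) else 0} := by
      have e' : ∀ ω, -S i ω = ∑ t ∈ Finset.range k,
          if N (X t ω) ≤ R then -F i (X t ω) (Z t ω) else 0 := fun ω => by
        rw [hS, ← Finset.sum_neg_distrib]
        refine Finset.sum_congr rfl fun t _ => ?_
        split_ifs <;> simp
      simp only [hB3, e']
    rw [e]
    exact measure_truncated_sum_ge_le hX hZ hlaw hind hN hN0 (F := fun x z => -F i x z)
      (hF i).neg (fun x => by rw [integral_neg, hF0 i x, neg_zero]) hg0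
      (fun x z => by rw [abs_neg]; exact hFg i x z) hθ hg (by positivity) (by omega) u
  set Bad : Set Ω := (⋃ t ∈ Finset.range k, B1 t) ∪ ((⋃ i ∈ Finset.univ, B2 i) ∪
    ⋃ i ∈ Finset.univ, B3 i) with hBad
  have hBadm : MeasurableSet Bad :=
    (Finset.measurableSet_biUnion _ fun t _ => hB1m t).union
      ((Finset.measurableSet_biUnion _ fun i _ => hB2m i).union
        (Finset.measurableSet_biUnion _ fun i _ => hB3m i))
  have hBadP : P.real Bad ≤ δ := by
    have h1 : P.real (⋃ t ∈ Finset.range k, B1 t) ≤ δ / 2 := by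
      refine (measureReal_biUnion_finset_le _ _).trans
        ((Finset.sum_le_sum fun t _ => hP1 t).trans ?_)
      rw [Finset.sum_const, Finset.card_range, nsmul_eq_mul]
      apply le_of_eq
      field_simp
    have h4 : (m : ℝ) * (δ / (4 * (m + 1))) ≤ δ / 4 := by
      rw [mul_div_assoc', div_le_div_iff₀ (by positivity) (by norm_num)]
      nlinarith
    have h2 : P.real (⋃ i ∈ Finset.univ, B2 i) ≤ δ / 4 := by
      refine (measureReal_biUnion_finset_le _ _).trans
        ((Finset.sum_le_sum fun t _ => hP2 t).trans ?_)
      rwa [Finset.sum_const, Finset.card_univ, nsmul_eq_mul]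
    have h3 : P.real (⋃ i ∈ Finset.univ, B3 i) ≤ δ / 4 := by
      refine (measureReal_biUnion_finset_le _ _).trans
        ((Finset.sum_le_sum fun t _ => hP3 t).trans ?_)
      rwa [Finset.sum_const, Finset.card_univ, nsmul_eq_mul]
    refine (measureReal_union_le _ _).trans ?_
    have := measureReal_union_le (μ := P) (⋃ i ∈ Finset.univ, B2 i) (⋃ i ∈ Finset.univ, B3 i)
    linarith
  refine ⟨Badᶜ, hBadm.compl, ?_, fun ω hω i => ?_⟩
  · rw [probReal_compl_eq_one_sub hBadm]
    linarith
  · simp only [hBad, Set.compl_union, Set.mem_inter_iff, Set.mem_compl_iff, Set.mem_iUnion,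
      Finset.mem_range, Finset.mem_univ, exists_prop, true_and, not_exists, not_and] at hω
    obtain ⟨ω1, ω2, ω3⟩ := hω
    have hSi : ∑ t ∈ Finset.range k, F i (X t ω) (Z t ω) = S i ω := by
      refine Finset.sum_congr rfl fun t ht => (if_pos ?_).symm
      exact (not_le.1 (ω1 t (Finset.mem_range.1 ht))).le
    have h2 : S i ω < T := not_le.1 (ω2 i)
    have h3 : -S i ω < T := not_le.1 (ω3 i)
    rw [hSi]
    refine (abs_le.2 ⟨by linarith, h2.le⟩).trans ?_
    have hR1 : 1 + R ≤ (2 + Real.log (2 * C)) * L := by rw [hR]; nlinarith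
    have hu1 : u ≤ (c + Real.log (4 * (m + 1)) + 1) * L := by
      have : u ≤ c + Real.log (4 * (m + 1)) + L := by rw [hu]; linarith
      nlinarith
    have hu0 : 0 ≤ u := by rw [hu]; linarith
    calc T ≤ θ⁻¹ * ((2 + Real.log (2 * C)) * L) ^ 4 * √k *
          ((c + Real.log (4 * (m + 1)) + 1) * L) := by
          rw [hT]
          gcongr
      _ = _ := by ring

/-- A state process that contracts up to an additive noise, in the sense of a function `N`, has
exponential moments bounded uniformly in time. -/
theorem lintegral_exp_le_of_contraction {Ω : Type*} [MeasurableSpace Ω] {P : Measure Ω}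
    {ξ ζ : ℕ → Ω → ℝ} (hζ : ∀ k, Measurable (ζ k)) {r C : ℝ} (hr0 : 0 ≤ r) (hr1 : r < 1)
    (hstep : ∀ k ω, ξ (k + 1) ω ≤ r * ξ k ω + ζ k ω)
    (h0 : ∫⁻ ω, ENNReal.ofReal (Real.exp (ξ 0 ω)) ∂P ≤ ENNReal.ofReal C)
    (hC : ∀ k, ∫⁻ ω, ENNReal.ofReal (Real.exp (ζ k ω / (1 - r))) ∂P ≤ ENNReal.ofReal C) (k : ℕ) :
    ∫⁻ ω, ENNReal.ofReal (Real.exp (ξ k ω)) ∂P ≤ ENNReal.ofReal C := by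
  induction k with
  | zero => exact h0
  | succ k ih =>
    have h1r : 0 < 1 - r := by linarith
    calc ∫⁻ ω, ENNReal.ofReal (Real.exp (ξ (k + 1) ω)) ∂P
        ≤ ∫⁻ ω, (ENNReal.ofReal r * ENNReal.ofReal (Real.exp (ξ k ω)) +
            ENNReal.ofReal (1 - r) * ENNReal.ofReal (Real.exp (ζ k ω / (1 - r)))) ∂P := by
          refine lintegral_mono fun ω => ?_
          dsimp only
          rw [← ENNReal.ofReal_mul hr0, ← ENNReal.ofReal_mul h1r.le,
            ← ENNReal.ofReal_add (by positivity) (by positivity)]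
          refine ENNReal.ofReal_le_ofReal ((Real.exp_le_exp.2 (hstep k ω)).trans ?_)
          have := convexOn_exp.2 (Set.mem_univ (ξ k ω)) (Set.mem_univ (ζ k ω / (1 - r))) hr0 h1r.le
            (by ring)
          simp only [smul_eq_mul] at this
          rwa [mul_div_cancel₀ _ h1r.ne'] at this
      _ = ENNReal.ofReal r * ∫⁻ ω, ENNReal.ofReal (Real.exp (ξ k ω)) ∂P +
            ENNReal.ofReal (1 - r) * ∫⁻ ω, ENNReal.ofReal (Real.exp (ζ k ω / (1 - r))) ∂P := by
          have := hζ k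
          rw [lintegral_add_right _ (by fun_prop), lintegral_const_mul' _ _ (by simp),
            lintegral_const_mul' _ _ (by simp)]
      _ ≤ ENNReal.ofReal r * ENNReal.ofReal C + ENNReal.ofReal (1 - r) * ENNReal.ofReal C := by
          gcongr
          exact hC k
      _ = ENNReal.ofReal C := by
          rw [← add_mul, ← ENNReal.ofReal_add hr0 h1r.le]
          simp

/-! ### Centred Gaussian measures -/

theorem isOpenPosMeasure_map {E F : Type*} [TopologicalSpace E] [MeasurableSpace E] [BorelSpace E]
    [TopologicalSpace F] [MeasurableSpace F] [BorelSpace F] (μ : Measure E) [μ.IsOpenPosMeasure]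
    {f : E → F} (hf : Continuous f) (hs : Function.Surjective f) : (μ.map f).IsOpenPosMeasure where
  open_pos U hU hne := by
    rw [Measure.map_apply hf.measurable hU.measurableSet]
    exact (hU.preimage hf).measure_ne_zero μ (hne.preimage hs)

/-- A nondegenerate Gaussian measure charges every nonempty open set. -/
theorem isOpenPosMeasure_multivariateGaussian {n : ℕ} {W : Matrix (Fin n) (Fin n) ℝ}
    (hW : W.PosDef) : (multivariateGaussian 0 W).IsOpenPosMeasure := by
  have h1 : (gaussianReal 0 1).IsOpenPosMeasure :=
    (gaussianReal_absolutelyContinuous' 0 one_ne_zero).isOpenPosMeasure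
  have h2 : (stdGaussian (EuclideanSpace ℝ (Fin n))).IsOpenPosMeasure := by
    rw [← map_pi_eq_stdGaussian]
    exact isOpenPosMeasure_map _ (PiLp.continuous_toLp 2 _) (WithLp.toLp_surjective 2)
  refine isOpenPosMeasure_map _ (by fun_prop) fun y => ?_
  have hS : CFC.sqrt W * CFC.sqrt W = W := CFC.sqrt_mul_sqrt_self W hW.posSemidef.nonneg
  have hu : IsUnit (CFC.sqrt W) := isUnit_of_mul_isUnit_left (y := CFC.sqrt W)
    (by rw [hS]; exact hW.isUnit)
  obtain ⟨U, hU⟩ := hu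
  refine ⟨WithLp.toLp 2 ((↑U⁻¹ : Matrix (Fin n) (Fin n) ℝ) *ᵥ y.ofLp), ?_⟩
  rw [Matrix.toEuclideanCLM_toLp, Matrix.mulVec_mulVec, ← hU, U.mul_inv]
  simp

theorem integrable_exp_mul_norm {E : Type*} [NormedAddCommGroup E] [NormedSpace ℝ E]
    [MeasurableSpace E] [BorelSpace E] [CompleteSpace E] [SecondCountableTopology E]
    (μ : Measure E) [IsGaussian μ] (b : ℝ) :
    Integrable (fun x => Real.exp (b * ‖x‖)) μ := by
  obtain ⟨ε, hε, hi⟩ := IsGaussian.exists_integrable_exp_sq μ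
  refine (hi.const_mul (Real.exp (b ^ 2 / (4 * ε)))).mono' (by fun_prop)
    (Eventually.of_forall fun x => ?_)
  rw [Real.norm_eq_abs, abs_of_pos (Real.exp_pos _), ← Real.exp_add]
  refine Real.exp_le_exp.2 ?_
  have : b ^ 2 / (4 * ε) + ε * ‖x‖ ^ 2 - b * ‖x‖ = (b - 2 * ε * ‖x‖) ^ 2 / (4 * ε) := by
    field_simp
    ring
  nlinarith [div_nonneg (sq_nonneg (b - 2 * ε * ‖x‖)) (show 0 ≤ 4 * ε by positivity)]

section Moments

variable {n : ℕ} {W : Matrix (Fin n) (Fin n) ℝ}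

theorem memLp_coord_multivariateGaussian (i : Fin n) :
    MemLp (fun w : EuclideanSpace ℝ (Fin n) => w i) 2 (multivariateGaussian 0 W) :=
  (IsGaussian.memLp_two_id (μ := multivariateGaussian 0 W)).mono (by fun_prop)
    (Eventually.of_forall fun w => PiLp.norm_apply_le w i)

theorem integrable_coord_multivariateGaussian (i : Fin n) :
    Integrable (fun w : EuclideanSpace ℝ (Fin n) => w i) (multivariateGaussian 0 W) :=
  (memLp_coord_multivariateGaussian i).integrable (by norm_num)

theorem integrable_coord_mul_coord_multivariateGaussian (i j : Fin n) :
    Integrable (fun w : EuclideanSpace ℝ (Fin n) => w i * w j) (multivariateGaussian 0 W) :=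
  (memLp_coord_multivariateGaussian i).integrable_mul (memLp_coord_multivariateGaussian j)

theorem integral_coord_multivariateGaussian (i : Fin n) :
    ∫ w, w i ∂(multivariateGaussian 0 W) = 0 := by
  have h := ContinuousLinearMap.integral_comp_comm (EuclideanSpace.proj (𝕜 := ℝ) i)
    (IsGaussian.integrable_fun_id (μ := multivariateGaussian (0 : EuclideanSpace ℝ (Fin n)) W))
  simpa using h

theorem integral_coord_mul_coord_multivariateGaussian (hW : W.PosSemidef) (i j : Fin n) :
    ∫ w, w i * w j ∂(multivariateGaussian 0 W) = W i j := by
  rw [← covariance_eval_multivariateGaussian (μ := 0) hW i j,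
    covariance_eq_sub (memLp_coord_multivariateGaussian i) (memLp_coord_multivariateGaussian j),
    integral_coord_multivariateGaussian]
  simp

end Moments

/-! ### Positive definite quadratic forms -/

/-- A continuous quadratic functional, positive on the nonzero vectors of a subspace, dominates a
multiple of the squared Euclidean norm there. -/
theorem exists_pos_mul_dotProduct_le {κ : Type*} [Fintype κ] (V : Submodule ℝ (κ → ℝ))
    {J : (κ → ℝ) → ℝ} (hJ : Continuous J) (hom : ∀ (a : ℝ) p, J (a • p) = a ^ 2 * J p)
    (hpos : ∀ p ∈ V, p ≠ 0 → 0 < J p) : ∃ c > 0, ∀ p ∈ V, c * (p ⬝ᵥ p) ≤ J p := by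
  have hcard : ∀ p : κ → ℝ, p ⬝ᵥ p ≤ Fintype.card κ * ‖p‖ ^ 2 := by
    intro p
    rw [← nsmul_eq_mul, ← Finset.card_univ]
    refine Finset.sum_le_card_nsmul _ _ _ fun i _ => ?_
    have := norm_le_pi_norm p i
    rw [Real.norm_eq_abs] at this
    rw [← sq, ← sq_abs]
    gcongr
  have hJ0 : J 0 = 0 := by simpa using hom 0 0
  obtain ⟨c, hc, h⟩ : ∃ c > 0, ∀ p ∈ V, c * ‖p‖ ^ 2 ≤ J p := by
    have hcomp : IsCompact (Metric.sphere (0 : κ → ℝ) 1 ∩ V) :=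
      (isCompact_sphere 0 1).inter_right V.closed_of_finiteDimensional
    have main : ∀ c, (∀ q ∈ Metric.sphere (0 : κ → ℝ) 1 ∩ V, c ≤ J q) →
        ∀ p ∈ V, c * ‖p‖ ^ 2 ≤ J p := by
      intro c hc p hp
      rcases eq_or_ne p 0 with rfl | h0
      · simp [hJ0]
      · have hn : ‖p‖ ≠ 0 := norm_ne_zero_iff.2 h0
        have h1 := hc (‖p‖⁻¹ • p) ⟨by simp [norm_smul, hn], V.smul_mem _ hp⟩
        rw [hom, inv_pow, ← div_eq_inv_mul, le_div_iff₀ (by positivity)] at h1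
        exact h1
    rcases (Metric.sphere (0 : κ → ℝ) 1 ∩ V).eq_empty_or_nonempty with he | hne
    · exact ⟨1, one_pos, main 1 (by simp [he])⟩
    · obtain ⟨q, hq, hmin⟩ := hcomp.exists_isMinOn hne hJ.continuousOn
      refine ⟨J q, hpos q hq.2 ?_, main _ fun q' hq' => hmin hq'⟩
      rintro rfl
      simpa using hq.1
  refine ⟨c / (Fintype.card κ + 1), by positivity, fun p hp => ?_⟩
  refine le_trans ?_ (h p hp)
  rw [div_mul_eq_mul_div, div_le_iff₀ (by positivity)]
  nlinarith [hcard p, sq_nonneg ‖p‖, mul_nonneg hc.le (sq_nonneg ‖p‖)]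

theorem exists_pos_mul_dotProduct_le_integral {κ E : Type*} [Fintype κ] [TopologicalSpace E]
    [MeasurableSpace E] [BorelSpace E] (ν : Measure E) [ν.IsOpenPosMeasure] {m : κ → E → ℝ}
    (hm : ∀ i, Continuous (m i)) {ψ : E → ℝ} (hψ : Continuous ψ) (hψ0 : ∀ w, 0 < ψ w)
    (hint : ∀ i j, Integrable (fun w => ψ w * (m i w * m j w)) ν) (V : Submodule ℝ (κ → ℝ))
    (hinj : ∀ p ∈ V, (∀ w, ∑ i, p i * m i w = 0) → p = 0) :
    ∃ c > 0, ∀ p ∈ V, c * (p ⬝ᵥ p) ≤ ∫ w, ψ w * (∑ i, p i * m i w) ^ 2 ∂ν := by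
  have hexp : ∀ (p : κ → ℝ) (w : E), ψ w * (∑ i, p i * m i w) ^ 2
      = ∑ i, ∑ j, p i * p j * (ψ w * (m i w * m j w)) := by
    intro p w
    rw [sq, Finset.sum_mul_sum, Finset.mul_sum]
    refine Finset.sum_congr rfl fun i _ => ?_
    rw [Finset.mul_sum]
    exact Finset.sum_congr rfl fun j _ => by ring
  have hi : ∀ p : κ → ℝ, Integrable (fun w => ψ w * (∑ i, p i * m i w) ^ 2) ν := by
    intro p
    simp only [hexp]
    exact integrable_finsetSum _ fun i _ => integrable_finsetSum _ fun j _ =>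
      (hint i j).const_mul _
  refine exists_pos_mul_dotProduct_le V ?_ (fun a p => ?_) fun p hp hp0 => ?_
  · have : (fun p : κ → ℝ => ∫ w, ψ w * (∑ i, p i * m i w) ^ 2 ∂ν)
        = fun p => ∑ i, ∑ j, p i * p j * ∫ w, ψ w * (m i w * m j w) ∂ν := by
      funext p
      simp only [hexp]
      rw [integral_finsetSum _ fun i _ => integrable_finsetSum _ fun j _ =>
        (hint i j).const_mul _]
      refine Finset.sum_congr rfl fun i _ => ?_
      rw [integral_finsetSum _ fun j _ => (hint i j).const_mul _]
      exact Finset.sum_congr rfl fun j _ => integral_const_mul _ _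
    rw [this]
    fun_prop
  · rw [← integral_const_mul]
    refine integral_congr_ae (Eventually.of_forall fun w => ?_)
    simp only [Pi.smul_apply, smul_eq_mul, mul_assoc, ← Finset.mul_sum]
    ring
  · have hnn : 0 ≤ fun w => ψ w * (∑ i, p i * m i w) ^ 2 :=
      fun w => mul_nonneg (hψ0 w).le (sq_nonneg _)
    refine lt_of_le_of_ne (integral_nonneg hnn) fun h => hp0 (hinj p hp fun w => ?_)
    have h1 := (integral_eq_zero_iff_of_nonneg hnn (hi p)).1 h.symm
    have h2 := (Continuous.ae_eq_iff_eq ν (by fun_prop) continuous_const).1 h1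
    have h3 : ψ w * (∑ i, p i * m i w) ^ 2 = 0 := congrFun h2 w
    simpa [(hψ0 w).ne'] using h3

/-! ### Quadratic features of the states -/

/-- The vectorizations of the symmetric matrices. -/
def symVec (n : ℕ) : Submodule ℝ (Fin n × Fin n → ℝ) where
  carrier := {v | ∀ i j, v (i, j) = v (j, i)}
  add_mem' ha hb i j := by simp [ha i j, hb i j]
  zero_mem' i j := rfl
  smul_mem' c v hv i j := by simp [hv i j]

theorem mem_symVec {n : ℕ} {v : Fin n × Fin n → ℝ} : v ∈ symVec n ↔ ∀ i j, v (i, j) = v (j, i) :=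
  Iff.rfl

/-- The quadratic features `y_i y_j` of a vector, i.e. `vec (y yᵀ)`. -/
def quadFeature {n : ℕ} (y : Fin n → ℝ) : Fin n × Fin n → ℝ := fun p => y p.1 * y p.2

theorem quadFeature_mem_symVec {n : ℕ} (y : Fin n → ℝ) : quadFeature y ∈ symVec n :=
  fun _ _ => mul_comm _ _

theorem continuous_quadFeature {n : ℕ} (p : Fin n × Fin n) :
    Continuous fun y : Fin n → ℝ => quadFeature y p := by
  unfold quadFeature
  fun_prop

/-- A weight that makes quartic functions of the noise bounded. -/
noncomputable def quarticWeight {n : ℕ} (w : EuclideanSpace ℝ (Fin n)) : ℝ := ((1 + ‖w‖) ^ 4)⁻¹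

theorem quarticWeight_pos {n : ℕ} (w : EuclideanSpace ℝ (Fin n)) : 0 < quarticWeight w := by
  unfold quarticWeight
  positivity

theorem quarticWeight_le_one {n : ℕ} (w : EuclideanSpace ℝ (Fin n)) : quarticWeight w ≤ 1 :=
  inv_le_one_of_one_le₀ (one_le_pow₀ (by linarith [norm_nonneg w]))

theorem continuous_quarticWeight {n : ℕ} :
    Continuous (quarticWeight : EuclideanSpace ℝ (Fin n) → ℝ) := by
  unfold quarticWeight
  exact Continuous.inv₀ (by fun_prop) fun w => by positivity

theorem abs_coord_le {n : ℕ} (w : EuclideanSpace ℝ (Fin n)) (i : Fin n) : |w i| ≤ ‖w‖ := by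
  simpa using PiLp.norm_apply_le w i

/-- Given the current state, the weighted second moment matrix of the next quadratic features is
positive definite on symmetric matrices, uniformly in the mean `μ` of the next state. The reason is
that a quadratic polynomial which vanishes almost surely under a nondegenerate Gaussian is zero. -/
theorem exists_pos_le_integral_quadFeature {n : ℕ} {W : Matrix (Fin n) (Fin n) ℝ}
    (hW : W.PosDef) : ∃ c > 0, ∀ (μ : Fin n → ℝ), ∀ v ∈ symVec n,
      c * (v ⬝ᵥ v) ≤ ∫ w, quarticWeight w * (quadFeature (μ + w.ofLp) ⬝ᵥ v) ^ 2
        ∂(multivariateGaussian 0 W) := by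
  have := isOpenPosMeasure_multivariateGaussian hW
  set m : Unit ⊕ Fin n ⊕ (Fin n × Fin n) → EuclideanSpace ℝ (Fin n) → ℝ := fun i w =>
    Sum.elim (fun _ => 1) (Sum.elim (fun k => w k) fun p => w p.1 * w p.2) i with hm
  have hmc : ∀ i, Continuous (m i) := by
    rintro (i | i | i) <;> simp only [hm, Sum.elim_inl, Sum.elim_inr] <;> fun_prop
  have hmb : ∀ i w, |m i w| ≤ (1 + ‖w‖) ^ 2 := by
    rintro (i | i | i) w <;> simp only [hm, Sum.elim_inl, Sum.elim_inr]
    · rw [abs_one]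
      nlinarith [norm_nonneg w]
    · nlinarith [norm_nonneg w, abs_coord_le w i]
    · rw [abs_mul]
      nlinarith [norm_nonneg w, abs_coord_le w i.1, abs_coord_le w i.2, abs_nonneg (w i.1),
        abs_nonneg (w i.2)]
  have hint : ∀ i j, Integrable (fun w => quarticWeight w * (m i w * m j w))
      (multivariateGaussian 0 W) := by
    intro i j
    refine (integrable_const (1 : ℝ)).mono' ?_ (Eventually.of_forall fun w => ?_)
    · exact (continuous_quarticWeight.mul ((hmc i).mul (hmc j))).aestronglyMeasurable
    · rw [Real.norm_eq_abs, abs_mul, abs_of_pos (quarticWeight_pos w), abs_mul, quarticWeight,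
        inv_mul_le_iff₀ (by positivity), mul_one]
      calc |m i w| * |m j w| ≤ (1 + ‖w‖) ^ 2 * (1 + ‖w‖) ^ 2 := by
            gcongr
            · exact hmb i w
            · exact hmb j w
        _ = (1 + ‖w‖) ^ 4 := by ring
  obtain ⟨c, hc, h⟩ := exists_pos_mul_dotProduct_le_integral (multivariateGaussian 0 W) hmc
    continuous_quarticWeight quarticWeight_pos hint
    ((symVec n).comap (LinearMap.funLeft ℝ ℝ fun p => Sum.inr (Sum.inr p))) (by
      intro p hp h0
      have hsym : ∀ i j, p (Sum.inr (Sum.inr (i, j))) = p (Sum.inr (Sum.inr (j, i))) := fun i j =>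
        mem_symVec.1 (Submodule.mem_comap.1 hp) i j
      simp only [hm, Fintype.sum_sum_type, Sum.elim_inl, Sum.elim_inr, Finset.univ_unique,
        Finset.sum_singleton, mul_one, Fintype.sum_prod_type] at h0
      have ha : p (Sum.inl ()) = 0 := by simpa using h0 0
      have h1 : ∀ i, p (Sum.inr (Sum.inl i)) + p (Sum.inr (Sum.inr (i, i))) = 0 := by
        intro i
        simpa [ha, Pi.single_apply] using h0 (WithLp.toLp 2 (Pi.single i 1))
      have h2 : ∀ i, -p (Sum.inr (Sum.inl i)) + p (Sum.inr (Sum.inr (i, i))) = 0 := by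
        intro i
        simpa [ha, Pi.single_apply] using h0 (WithLp.toLp 2 (-Pi.single i 1))
      have h3 : ∀ i, p (Sum.inr (Sum.inl i)) = 0 := fun i => by linarith [h1 i, h2 i]
      have h4 : ∀ i, p (Sum.inr (Sum.inr (i, i))) = 0 := fun i => by linarith [h1 i, h2 i]
      funext i
      rcases i with i | i | ⟨i, j⟩
      · exact ha
      · exact h3 i
      · have := h0 (WithLp.toLp 2 (Pi.single i 1 + Pi.single j 1))
        simp [ha, h3, Pi.single_apply, mul_add, Finset.sum_add_distrib, h4] at this
        have := hsym i j
        simp only [Pi.zero_apply]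
        linarith)
  refine ⟨c, hc, fun μ v hv => ?_⟩
  set p : Unit ⊕ Fin n ⊕ (Fin n × Fin n) → ℝ := Sum.elim (fun _ => quadFeature μ ⬝ᵥ v)
    (Sum.elim (fun k => ∑ i, (v (k, i) + v (i, k)) * μ i) v) with hp
  have h1 := h p hv
  have h2 : v ⬝ᵥ v ≤ p ⬝ᵥ p := by
    simp only [dotProduct, hp, Fintype.sum_sum_type, Sum.elim_inl, Sum.elim_inr]
    have e1 : 0 ≤ ∑ x : Unit, (∑ i, quadFeature μ i * v i) * ∑ i, quadFeature μ i * v i :=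
      Finset.sum_nonneg fun i _ => mul_self_nonneg _
    have e2 : 0 ≤ ∑ k, (∑ i, (v (k, i) + v (i, k)) * μ i) * ∑ i, (v (k, i) + v (i, k)) * μ i :=
      Finset.sum_nonneg fun i _ => mul_self_nonneg _
    linarith
  have h3 : ∀ w : EuclideanSpace ℝ (Fin n),
      ∑ i, p i * m i w = quadFeature (μ + w.ofLp) ⬝ᵥ v := by
    intro w
    simp only [hp, hm, Fintype.sum_sum_type, Sum.elim_inl, Sum.elim_inr, Finset.univ_unique,
      Finset.sum_singleton, mul_one, dotProduct, quadFeature, Fintype.sum_prod_type, Pi.add_apply]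
    have e : ∑ k, (∑ i, (v (k, i) + v (i, k)) * μ i) * w k
        = ∑ k, ∑ i, (μ k * w i + w k * μ i) * v (k, i) := by
      simp only [Finset.sum_mul, add_mul, Finset.sum_add_distrib]
      rw [add_comm, Finset.sum_comm]
      congr 1 <;> refine Finset.sum_congr rfl fun i _ => Finset.sum_congr rfl fun j _ => by ring
    rw [e, ← Finset.sum_add_distrib, ← Finset.sum_add_distrib]
    refine Finset.sum_congr rfl fun i _ => ?_
    rw [← Finset.sum_add_distrib, ← Finset.sum_add_distrib]
    exact Finset.sum_congr rfl fun j _ => by ring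
  simp only [h3] at h1
  exact (mul_le_mul_of_nonneg_left h2 hc.le).trans h1

/-! ### The error of an instrumental variable regression -/

/-- The Euclidean norm of a finitely indexed vector; the norm instance on functions is the supremum
norm. -/
noncomputable def vecNorm {κ : Type*} [Fintype κ] (v : κ → ℝ) : ℝ := √(v ⬝ᵥ v)

section VecNorm

variable {κ : Type*} [Fintype κ]

theorem vecNorm_nonneg (v : κ → ℝ) : 0 ≤ vecNorm v := Real.sqrt_nonneg _

theorem dotProduct_self_nonneg (v : κ → ℝ) : 0 ≤ v ⬝ᵥ v :=
  Finset.sum_nonneg fun _ _ => mul_self_nonneg _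

theorem vecNorm_sq (v : κ → ℝ) : vecNorm v ^ 2 = v ⬝ᵥ v := Real.sq_sqrt (dotProduct_self_nonneg v)

theorem vecNorm_eq_zero {v : κ → ℝ} (h : vecNorm v = 0) : v = 0 := by
  have := vecNorm_sq v
  rw [h] at this
  exact dotProduct_self_eq_zero.1 (by linarith)

theorem abs_le_vecNorm (v : κ → ℝ) (i : κ) : |v i| ≤ vecNorm v := by
  refine Real.abs_le_sqrt ?_
  rw [sq]
  exact Finset.single_le_sum (f := fun i => v i * v i) (fun j _ => mul_self_nonneg _)
    (Finset.mem_univ i)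

theorem dotProduct_le_vecNorm_mul_vecNorm (u v : κ → ℝ) : u ⬝ᵥ v ≤ vecNorm u * vecNorm v := by
  have := Real.sum_mul_le_sqrt_mul_sqrt Finset.univ u v
  simpa [vecNorm, dotProduct, sq] using this

theorem abs_dotProduct_mulVec_le (E : Matrix κ κ ℝ) {D : ℝ} (hE : ∀ p q, |E p q| ≤ D)
    (u v : κ → ℝ) :
    |u ⬝ᵥ (E *ᵥ v)| ≤ D * Fintype.card κ ^ 2 * vecNorm u * vecNorm v := by
  have h1 : ∀ p q, |u p * (E p q * v q)| ≤ D * vecNorm u * vecNorm v := by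
    intro p q
    rw [abs_mul, abs_mul]
    have hD := (abs_nonneg _).trans (hE p q)
    calc |u p| * (|E p q| * |v q|) ≤ vecNorm u * (D * vecNorm v) := by
          gcongr
          · exact vecNorm_nonneg u
          · exact abs_le_vecNorm u p
          · exact hE p q
          · exact abs_le_vecNorm v q
      _ = _ := by ring
  have h2 : u ⬝ᵥ (E *ᵥ v) = ∑ p, ∑ q, u p * (E p q * v q) := by
    simp only [dotProduct, Matrix.mulVec, Finset.mul_sum]
  rw [h2]
  refine (Finset.abs_sum_le_sum_abs _ _).trans ?_
  refine (Finset.sum_le_sum fun p _ => (Finset.abs_sum_le_sum_abs _ _).trans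
    (Finset.sum_le_sum fun q _ => h1 p q)).trans ?_
  simp only [Finset.sum_const, Finset.card_univ, nsmul_eq_mul]
  apply le_of_eq
  ring

theorem vecNorm_mulVec_le (E : Matrix κ κ ℝ) {D : ℝ} (hE : ∀ p q, |E p q| ≤ D) (hD : 0 ≤ D)
    (v : κ → ℝ) : vecNorm (E *ᵥ v) ≤ D * Fintype.card κ ^ 2 * vecNorm v := by
  rcases (vecNorm_nonneg (E *ᵥ v)).eq_or_lt with h | h
  · rw [← h]
    exact mul_nonneg (by positivity) (vecNorm_nonneg v)
  · have h1 := (le_abs_self _).trans (abs_dotProduct_mulVec_le E hE (E *ᵥ v) v)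
    rw [← vecNorm_sq] at h1
    refine le_of_mul_le_mul_left ?_ h
    calc _ = vecNorm (E *ᵥ v) ^ 2 := by ring
      _ ≤ _ := h1
      _ = _ := by ring

/-- Deterministic error bound for the pseudo-inverse solution of `(Φᵀ Ψ) x = Φᵀ c`, where
`Ψ = Φ B - Ξ` on the subspace `V` and `c = Φ B h`. If the Gram matrix `Φᵀ Φ` is at least `g` on `V`,
`B` expands by at least `b` and the entries of `Φᵀ Ξ` are at most `D`, then the relative error is at
most of order `D / (g b)`. -/
theorem vecNorm_regression_error_le {τ : ℕ} (Φ Ψ Ξ : Matrix (Fin τ) κ ℝ) (c : Fin τ → ℝ)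
    (B : (κ → ℝ) → κ → ℝ) (V : Submodule ℝ (κ → ℝ)) (hΨV : ∀ t, Ψ t ∈ V) (hBV : ∀ v ∈ V, B v ∈ V)
    (hΨ : ∀ v ∈ V, Ψ *ᵥ v = Φ *ᵥ B v - Ξ *ᵥ v) {h : κ → ℝ} (hh : h ∈ V) (hc : c = Φ *ᵥ B h)
    {b g D : ℝ} (hb : 0 < b) (hB : ∀ v ∈ V, b * vecNorm v ≤ vecNorm (B v)) (hg : 0 ≤ g)
    (hgram : ∀ u ∈ V, g * (u ⬝ᵥ u) ≤ (Φ *ᵥ u) ⬝ᵥ (Φ *ᵥ u)) (hD : 0 ≤ D)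
    (hnoise : ∀ p q, |(Φᵀ * Ξ) p q| ≤ D) (ha : 0 < g * b - D * Fintype.card κ ^ 2) :
    (g * b - D * Fintype.card κ ^ 2) * vecNorm (pinv (Φᵀ * Ψ) *ᵥ (Φᵀ *ᵥ c) - h)
      ≤ D * Fintype.card κ ^ 2 * vecNorm h := by
  set X := Φᵀ * Ψ with hX
  have hcr : Φᵀ *ᵥ c = X *ᵥ h + (Φᵀ * Ξ) *ᵥ h := by
    have : Φ *ᵥ B h = Ψ *ᵥ h + Ξ *ᵥ h := by rw [hΨ h hh, sub_add_cancel]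
    rw [hc, this, Matrix.mulVec_add, hX, Matrix.mulVec_mulVec, Matrix.mulVec_mulVec]
  have hlow : ∀ v ∈ V, (g * b - D * Fintype.card κ ^ 2) * vecNorm v ≤ vecNorm (X *ᵥ v) := by
    intro v hv
    have hu := hB v hv
    rcases (vecNorm_nonneg (B v)).eq_or_lt with h0 | h0
    · have : vecNorm v = 0 := by
        have := vecNorm_nonneg v
        rw [← h0] at hu
        nlinarith
      rw [this, mul_zero]
      exact vecNorm_nonneg _
    · have h1 : B v ⬝ᵥ (X *ᵥ v) = (Φ *ᵥ B v) ⬝ᵥ (Φ *ᵥ B v) - B v ⬝ᵥ ((Φᵀ * Ξ) *ᵥ v) := by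
        rw [hX, ← Matrix.mulVec_mulVec, ← Matrix.mulVec_mulVec, hΨ v hv, Matrix.mulVec_sub,
          dotProduct_sub]
        congr 1
        rw [Matrix.dotProduct_mulVec, Matrix.vecMul_transpose]
      have h2 := hgram (B v) (hBV v hv)
      have h3 := (le_abs_self _).trans (abs_dotProduct_mulVec_le _ hnoise (B v) v)
      have h4 := dotProduct_le_vecNorm_mul_vecNorm (B v) (X *ᵥ v)
      rw [← vecNorm_sq] at h2
      have h5 : vecNorm (B v) * (g * vecNorm (B v) - D * Fintype.card κ ^ 2 * vecNorm v)
          ≤ vecNorm (B v) * vecNorm (X *ᵥ v) := by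
        refine le_trans ?_ h4
        rw [h1]
        calc _ = g * vecNorm (B v) ^ 2 - D * Fintype.card κ ^ 2 * vecNorm (B v) * vecNorm v := by
              ring
          _ ≤ _ := sub_le_sub h2 h3
      have h6 := le_of_mul_le_mul_left h5 h0
      have h7 := mul_le_mul_of_nonneg_left hu hg
      linarith
  have hrow : ∀ u, Xᵀ *ᵥ u ∈ V := by
    intro u
    have : Xᵀ *ᵥ u = ∑ t, (Φ *ᵥ u) t • Ψ t := by
      rw [hX, Matrix.transpose_mul, Matrix.transpose_transpose, ← Matrix.mulVec_mulVec]
      funext p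
      simp [Matrix.mulVec, dotProduct, Finset.sum_apply, mul_comm]
    rw [this]
    exact V.sum_mem fun t _ => V.smul_mem _ (hΨV t)
  have hinj : ∀ v ∈ V, X *ᵥ v = 0 → v = 0 := by
    intro v hv h0
    have := hlow v hv
    rw [h0] at this
    have h0' : vecNorm (0 : κ → ℝ) = 0 := by simp [vecNorm]
    rw [h0'] at this
    refine vecNorm_eq_zero (le_antisymm ?_ (vecNorm_nonneg v))
    by_contra hc
    nlinarith [not_le.1 hc]
  obtain ⟨hΔ, hle⟩ := pinv_mulVec_error X V hrow hinj h hh ((Φᵀ * Ξ) *ᵥ h)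
  rw [← hcr] at hΔ hle
  calc _ ≤ vecNorm (X *ᵥ (pinv X *ᵥ (Φᵀ *ᵥ c) - h)) := hlow _ hΔ
    _ ≤ vecNorm ((Φᵀ * Ξ) *ᵥ h) := Real.sqrt_le_sqrt hle
    _ ≤ _ := vecNorm_mulVec_le _ hnoise hD h

end VecNorm

/-! ### The error of the LSTD estimator on a given trajectory -/

section Deterministic

variable {n d : ℕ}

/-- The operator `X ↦ X - Γᵀ X Γ` on vectorized matrices. -/
def bellmanDiff (Γ : Matrix (Fin n) (Fin n) ℝ) (v : Fin n × Fin n → ℝ) : Fin n × Fin n → ℝ :=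
  vec (unvec v - Γᵀ * unvec v * Γ)

theorem unvec_vec (A : Matrix (Fin n) (Fin n) ℝ) : unvec (vec A) = A := rfl

theorem vec_unvec (v : Fin n × Fin n → ℝ) : vec (unvec v) = v := rfl

theorem vec_mem_symVec {A : Matrix (Fin n) (Fin n) ℝ} : vec A ∈ symVec n ↔ Aᵀ = A :=
  ⟨fun h => Matrix.ext fun i j => h i j, fun h i j => congrFun (congrFun h i) j⟩

theorem bellmanDiff_mem_symVec (Γ : Matrix (Fin n) (Fin n) ℝ) {v : Fin n × Fin n → ℝ}
    (hv : v ∈ symVec n) : bellmanDiff Γ v ∈ symVec n := by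
  have h : (unvec v)ᵀ = unvec v := vec_mem_symVec.1 hv
  refine vec_mem_symVec.2 ?_
  simp [Matrix.transpose_sub, Matrix.transpose_mul, h, Matrix.mul_assoc]

theorem quadFeature_dotProduct (x : Fin n → ℝ) (v : Fin n × Fin n → ℝ) :
    quadFeature x ⬝ᵥ v = x ⬝ᵥ (unvec v *ᵥ x) := by
  simp only [dotProduct, quadFeature, Fintype.sum_prod_type, Matrix.mulVec, unvec, Matrix.of_apply,
    Finset.mul_sum]
  rw [Finset.sum_comm]
  exact Finset.sum_congr rfl fun i _ => Finset.sum_congr rfl fun j _ => by ring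

theorem quadFeature_dotProduct_bellmanDiff (Γ : Matrix (Fin n) (Fin n) ℝ) (x : Fin n → ℝ)
    (v : Fin n × Fin n → ℝ) :
    quadFeature x ⬝ᵥ bellmanDiff Γ v = quadFeature x ⬝ᵥ v - quadFeature (Γ *ᵥ x) ⬝ᵥ v := by
  rw [quadFeature_dotProduct, quadFeature_dotProduct, quadFeature_dotProduct, bellmanDiff,
    unvec_vec, Matrix.sub_mulVec, dotProduct_sub]
  congr 1
  rw [← Matrix.mulVec_mulVec, ← Matrix.mulVec_mulVec, Matrix.dotProduct_mulVec,
    Matrix.vecMul_transpose]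

theorem exists_bellmanDiff_expanding {Γ : Matrix (Fin n) (Fin n) ℝ} (hΓ : IsStable Γ) :
    ∃ b > 0, ∀ v ∈ symVec n, b * vecNorm v ≤ vecNorm (bellmanDiff Γ v) := by
  have hlin : ∀ (a : ℝ) v, bellmanDiff Γ (a • v) = a • bellmanDiff Γ v := by
    intro a v
    have : unvec (a • v) = a • unvec v := rfl
    rw [bellmanDiff, this, Matrix.mul_smul, Matrix.smul_mul, ← smul_sub]
    rfl
  have hcont : Continuous fun v => bellmanDiff Γ v ⬝ᵥ bellmanDiff Γ v := by
    simp only [dotProduct, bellmanDiff, vec, unvec, Matrix.sub_apply, Matrix.mul_apply,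
      Matrix.of_apply]
    fun_prop
  obtain ⟨c, hc, h⟩ := exists_pos_mul_dotProduct_le (symVec n) hcont
    (fun a v => by
      rw [hlin, smul_dotProduct, dotProduct_smul, smul_eq_mul, smul_eq_mul]
      ring)
    (fun v _ hv0 => by
      refine lt_of_le_of_ne (dotProduct_self_nonneg _) fun h0 => hv0 ?_
      have h1 : unvec v - Γᵀ * unvec v * Γ = 0 := by
        rw [← unvec_vec (unvec v - Γᵀ * unvec v * Γ)]
        change unvec (bellmanDiff Γ v) = 0
        rw [dotProduct_self_eq_zero.1 h0.symm]
        rfl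
      have h2 := eq_zero_of_eq_conj hΓ.tendsto_pow (sub_eq_zero.1 h1)
      rw [← vec_unvec v, h2]
      rfl)
  refine ⟨√c, Real.sqrt_pos.2 hc, fun v hv => ?_⟩
  rw [vecNorm, ← Real.sqrt_mul hc.le]
  exact Real.sqrt_le_sqrt (h v hv)

theorem frobNorm_sub_unvec (H : Matrix (Fin n) (Fin n) ℝ) (v : Fin n × Fin n → ℝ) :
    frobNorm (H - unvec v) = vecNorm (v - vec H) := by
  rw [frobNorm, vecNorm]
  congr 1
  simp only [dotProduct, Fintype.sum_prod_type, vec, unvec, Matrix.sub_apply, Matrix.of_apply,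
    Pi.sub_apply]
  rw [Finset.sum_comm]
  exact Finset.sum_congr rfl fun i _ => Finset.sum_congr rfl fun j _ => by ring

/-- The product of a feature of the state `x` and the noise in a feature of the next state
`Γ x + z`. -/
def noiseTerm (Γ W : Matrix (Fin n) (Fin n) ℝ) (p q : Fin n × Fin n) (x : Fin n → ℝ)
    (z : EuclideanSpace ℝ (Fin n)) : ℝ :=
  quadFeature x p * (quadFeature (Γ *ᵥ x + z.ofLp) q - quadFeature (Γ *ᵥ x) q - vec W q)

/-- The weighted product of two features of the next state `Γ x + z`, centred given `x`. -/
noncomputable def gramTerm (Γ W : Matrix (Fin n) (Fin n) ℝ) (p q : Fin n × Fin n) (x : Fin n → ℝ)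
    (z : EuclideanSpace ℝ (Fin n)) : ℝ :=
  quarticWeight z * (quadFeature (Γ *ᵥ x + z.ofLp) p * quadFeature (Γ *ᵥ x + z.ofLp) q) -
    ∫ w, quarticWeight w * (quadFeature (Γ *ᵥ x + w.ofLp) p * quadFeature (Γ *ᵥ x + w.ofLp) q)
      ∂(multivariateGaussian 0 W)

theorem abs_quadFeature_le (x : Fin n → ℝ) (p : Fin n × Fin n) : |quadFeature x p| ≤ ‖x‖ ^ 2 := by
  have h : ∀ i, |x i| ≤ ‖x‖ := fun i => norm_le_pi_norm x i
  rw [quadFeature, abs_mul, sq]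
  exact mul_le_mul (h _) (h _) (abs_nonneg _) (norm_nonneg _)

theorem norm_ofLp_le (z : EuclideanSpace ℝ (Fin n)) : ‖z.ofLp‖ ≤ ‖z‖ :=
  (pi_norm_le_iff_of_nonneg (norm_nonneg z)).2 fun i => PiLp.norm_apply_le z i

theorem abs_quarticWeight_mul_quadFeature_le (μ : Fin n → ℝ) (z : EuclideanSpace ℝ (Fin n))
    (p q : Fin n × Fin n) :
    |quarticWeight z * (quadFeature (μ + z.ofLp) p * quadFeature (μ + z.ofLp) q)|
      ≤ (1 + ‖μ‖) ^ 4 := by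
  have h1 : ‖μ + z.ofLp‖ ≤ (1 + ‖μ‖) * (1 + ‖z‖) := by
    have := (norm_add_le μ z.ofLp).trans (add_le_add_right (norm_ofLp_le z) _)
    nlinarith [norm_nonneg μ, norm_nonneg z, mul_nonneg (norm_nonneg μ) (norm_nonneg z)]
  have h2 : ∀ p, |quadFeature (μ + z.ofLp) p| ≤ ((1 + ‖μ‖) * (1 + ‖z‖)) ^ 2 := fun p =>
    (abs_quadFeature_le _ p).trans (by gcongr)
  rw [abs_mul, abs_of_pos (quarticWeight_pos z), quarticWeight, inv_mul_le_iff₀ (by positivity),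
    abs_mul]
  calc _ ≤ ((1 + ‖μ‖) * (1 + ‖z‖)) ^ 2 * ((1 + ‖μ‖) * (1 + ‖z‖)) ^ 2 := by
        gcongr
        · exact h2 p
        · exact h2 q
    _ = _ := by ring

theorem continuous_quarticWeight_mul_quadFeature (Γ : Matrix (Fin n) (Fin n) ℝ)
    (p q : Fin n × Fin n) : Continuous fun a : (Fin n → ℝ) × EuclideanSpace ℝ (Fin n) =>
      quarticWeight a.2 *
        (quadFeature (Γ *ᵥ a.1 + a.2.ofLp) p * quadFeature (Γ *ᵥ a.1 + a.2.ofLp) q) := by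
  have h : Continuous fun a : (Fin n → ℝ) × EuclideanSpace ℝ (Fin n) => Γ *ᵥ a.1 + a.2.ofLp := by
    fun_prop
  exact (continuous_quarticWeight.comp continuous_snd).mul
    (((continuous_quadFeature p).comp h).mul ((continuous_quadFeature q).comp h))

theorem integrable_quarticWeight_mul_quadFeature (Γ W : Matrix (Fin n) (Fin n) ℝ) (x : Fin n → ℝ)
    (p q : Fin n × Fin n) : Integrable (fun z => quarticWeight z *
        (quadFeature (Γ *ᵥ x + z.ofLp) p * quadFeature (Γ *ᵥ x + z.ofLp) q))
      (multivariateGaussian 0 W) := by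
  refine (integrable_const ((1 + ‖Γ *ᵥ x‖) ^ 4)).mono' ?_ (Eventually.of_forall fun z =>
    abs_quarticWeight_mul_quadFeature_le _ z p q)
  exact ((continuous_quarticWeight_mul_quadFeature Γ p q).comp
    (by fun_prop : Continuous fun z => (x, z))).aestronglyMeasurable

/-- The Gram matrix of the features is bounded below once the sums of the centred terms `gramTerm`
are small: conditionally on the past, every new feature vector contributes a positive definite
matrix. The first feature vector is discarded, since no noise precedes it in the sums. -/
theorem gram_lower_bound {Γ W : Matrix (Fin n) (Fin n) ℝ} {c : ℝ}
    (hc : ∀ (μ : Fin n → ℝ), ∀ v ∈ symVec n, c * (v ⬝ᵥ v) ≤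
      ∫ w, quarticWeight w * (quadFeature (μ + w.ofLp) ⬝ᵥ v) ^ 2 ∂(multivariateGaussian 0 W))
    {y : ℕ → Fin n → ℝ} {z : ℕ → EuclideanSpace ℝ (Fin n)}
    (hy : ∀ t, y (t + 1) = Γ *ᵥ y t + (z t).ofLp) {m : ℕ} {D : ℝ}
    (hD : ∀ p q, |∑ t ∈ Finset.range m, gramTerm Γ W p q (y t) (z t)| ≤ D)
    {u : Fin n × Fin n → ℝ} (hu : u ∈ symVec n) :
    (m * c - D * Fintype.card (Fin n × Fin n) ^ 2) * (u ⬝ᵥ u)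
      ≤ ∑ t ∈ Finset.range (m + 1), (quadFeature (y t) ⬝ᵥ u) ^ 2 := by
  set E : Matrix (Fin n × Fin n) (Fin n × Fin n) ℝ :=
    Matrix.of fun p q => ∑ t ∈ Finset.range m, gramTerm Γ W p q (y t) (z t) with hE
  have hsq : ∀ (x : Fin n → ℝ) (w : EuclideanSpace ℝ (Fin n)),
      quarticWeight w * (quadFeature (Γ *ᵥ x + w.ofLp) ⬝ᵥ u) ^ 2 = ∑ p, ∑ q, u p * (u q *
        (quarticWeight w *
          (quadFeature (Γ *ᵥ x + w.ofLp) p * quadFeature (Γ *ᵥ x + w.ofLp) q))) := by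
    intro x w
    rw [sq, dotProduct, Finset.sum_mul_sum, Finset.mul_sum]
    refine Finset.sum_congr rfl fun p _ => ?_
    rw [Finset.mul_sum]
    exact Finset.sum_congr rfl fun q _ => by ring
  have hterm : ∀ t, quarticWeight (z t) * (quadFeature (y (t + 1)) ⬝ᵥ u) ^ 2 =
      (∑ p, ∑ q, u p * (u q * gramTerm Γ W p q (y t) (z t))) +
        ∫ w, quarticWeight w * (quadFeature (Γ *ᵥ y t + w.ofLp) ⬝ᵥ u) ^ 2
          ∂(multivariateGaussian 0 W) := by
    intro t
    have hi := integrable_quarticWeight_mul_quadFeature Γ W (y t)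
    rw [hy t, hsq]
    simp only [hsq]
    rw [integral_finsetSum _ fun p _ => integrable_finsetSum _ fun q _ =>
      ((hi p q).const_mul _).const_mul _, ← Finset.sum_add_distrib]
    refine Finset.sum_congr rfl fun p _ => ?_
    rw [integral_finsetSum _ fun q _ => ((hi p q).const_mul _).const_mul _,
      ← Finset.sum_add_distrib]
    refine Finset.sum_congr rfl fun q _ => ?_
    rw [integral_const_mul, integral_const_mul, gramTerm]
    ring
  have hEu : ∑ t ∈ Finset.range m, (∑ p, ∑ q, u p * (u q * gramTerm Γ W p q (y t) (z t)))
      = u ⬝ᵥ (E *ᵥ u) := by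
    simp only [dotProduct, Matrix.mulVec, hE, Matrix.of_apply, Finset.mul_sum, Finset.sum_mul]
    rw [Finset.sum_comm]
    refine Finset.sum_congr rfl fun p _ => ?_
    rw [Finset.sum_comm]
    exact Finset.sum_congr rfl fun q _ => Finset.sum_congr rfl fun t _ => by ring
  have hEb := (abs_le.1 (abs_dotProduct_mulVec_le E (fun p q => hD p q) u u)).1
  have huu := vecNorm_sq u
  calc (m * c - D * Fintype.card (Fin n × Fin n) ^ 2) * (u ⬝ᵥ u)
      = -(D * Fintype.card (Fin n × Fin n) ^ 2 * vecNorm u * vecNorm u)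
        + ∑ t ∈ Finset.range m, c * (u ⬝ᵥ u) := by
        rw [Finset.sum_const, Finset.card_range, nsmul_eq_mul, ← huu]
        ring
    _ ≤ ∑ t ∈ Finset.range m, quarticWeight (z t) * (quadFeature (y (t + 1)) ⬝ᵥ u) ^ 2 := by
        simp only [hterm]
        rw [Finset.sum_add_distrib, hEu]
        exact add_le_add hEb (Finset.sum_le_sum fun t _ => hc _ u hu)
    _ ≤ ∑ t ∈ Finset.range m, (quadFeature (y (t + 1)) ⬝ᵥ u) ^ 2 :=
        Finset.sum_le_sum fun t _ =>
          mul_le_of_le_one_left (sq_nonneg _) (quarticWeight_le_one _)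
    _ ≤ _ := by
        rw [Finset.sum_range_succ' (fun t => (quadFeature (y t) ⬝ᵥ u) ^ 2)]
        linarith [sq_nonneg (quadFeature (y 0) ⬝ᵥ u)]

theorem featureMatrix_row (y : ℕ → Fin n → ℝ) (τ : ℕ) (t : Fin τ) :
    featureMatrix y τ t = quadFeature (y t) := by
  funext p
  exact mul_comm _ _

/-- On a trajectory along which the sums of the centred terms `noiseTerm` and `gramTerm` are at
most a small multiple of `τ`, the LSTD error is of order the size of these sums divided by `τ`. -/
theorem exists_lstd_error_bound {Γ W H M : Matrix (Fin n) (Fin n) ℝ} {N : Matrix (Fin d) (Fin d) ℝ}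
    {K : Matrix (Fin d) (Fin n) ℝ} (hΓ : IsStable Γ) (hW : W.PosDef) (hHs : Hᵀ = H)
    (hH : H = Γᵀ * H * Γ + (M + Kᵀ * N * K)) :
    ∃ κ > 0, ∃ A > 0, ∀ (y : ℕ → Fin n → ℝ) (z : ℕ → EuclideanSpace ℝ (Fin n)),
      (∀ t, y (t + 1) = Γ *ᵥ y t + (z t).ofLp) → ∀ (τ : ℕ) (D : ℝ), 2 ≤ τ → 0 ≤ D → D ≤ κ * τ →
      (∀ p q, |∑ t ∈ Finset.range τ, noiseTerm Γ W p q (y t) (z t)| ≤ D) →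
      (∀ p q, |∑ t ∈ Finset.range (τ - 1), gramTerm Γ W p q (y t) (z t)| ≤ D) →
      frobNorm (H - lstd K M N W y τ) ≤ A * (D / τ) := by
  obtain ⟨b, hb, hB⟩ := exists_bellmanDiff_expanding hΓ
  obtain ⟨c, hc, hgram⟩ := exists_pos_le_integral_quadFeature hW
  have hWs : Wᵀ = W := by
    simpa [Matrix.IsHermitian, Matrix.conjTranspose_eq_transpose_of_trivial] using hW.1
  set k2 : ℝ := (Fintype.card (Fin n × Fin n) : ℝ) ^ 2 with hk2
  have hk20 : 0 ≤ k2 := by positivity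
  have hh0 := vecNorm_nonneg (vec H)
  refine ⟨c * b / (8 * (k2 + 1) * (b + 1)), by positivity, 8 * (k2 * vecNorm (vec H) + 1) / (c * b),
    by positivity, fun y z hy τ D hτ hD hDκ hnoise hgr => ?_⟩
  have hτ2 : (2 : ℝ) ≤ τ := by exact_mod_cast hτ
  have hτ0 : (0 : ℝ) < τ := by linarith
  -- `D` is small against both `c τ` and `c b τ`
  have hDk : D * k2 * (8 * (b + 1)) ≤ c * b * τ := by
    rw [div_mul_eq_mul_div, le_div_iff₀ (by positivity)] at hDκ
    have : D * k2 * (8 * (b + 1)) ≤ D * (8 * (k2 + 1) * (b + 1)) := by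
      have : 0 ≤ D * (8 * (b + 1)) := by positivity
      nlinarith
    linarith
  have hDk0 : 0 ≤ D * k2 := by positivity
  have hD1 : D * k2 ≤ c * τ / 8 := by
    have h1 : D * k2 * 8 * b ≤ c * τ * b := by nlinarith
    have := le_of_mul_le_mul_right h1 hb
    linarith
  have hD2 : D * k2 ≤ c * b * τ / 8 := by nlinarith
  set Ξ : Matrix (Fin τ) (Fin n × Fin n) ℝ := Matrix.of fun t q =>
    quadFeature (y (t + 1)) q - quadFeature (Γ *ᵥ y t) q - vec W q with hΞ
  have hrow : ∀ (x : ℕ → Fin n → ℝ) (t : Fin τ) (v : Fin n × Fin n → ℝ),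
      (featureMatrix x τ *ᵥ v) t = quadFeature (x t) ⬝ᵥ v := by
    intro x t v
    rw [Matrix.mulVec, featureMatrix_row]
  have hcost : (fun t : Fin τ => lqCost M N (y t) (linPolicy K (y t)))
      = featureMatrix y τ *ᵥ bellmanDiff Γ (vec H) := by
    funext t
    have hQ : H - Γᵀ * H * Γ = M + Kᵀ * N * K := sub_eq_iff_eq_add'.2 hH
    rw [hrow, quadFeature_dotProduct, bellmanDiff, unvec_vec, unvec_vec, hQ, lqCost, linPolicy,
      Matrix.add_mulVec, dotProduct_add, Matrix.mulVec_neg, neg_dotProduct_neg]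
    congr 1
    rw [← Matrix.mulVec_mulVec, ← Matrix.mulVec_mulVec, Matrix.dotProduct_mulVec _ Kᵀ,
      Matrix.vecMul_transpose]
  have main := vecNorm_regression_error_le (featureMatrix y τ)
    (featureMatrix y τ - featureMatrix (fun t => y (t + 1)) τ + Matrix.of fun _ => vec W) Ξ
    (fun t : Fin τ => lqCost M N (y t) (linPolicy K (y t))) (bellmanDiff Γ) (symVec n)
    (fun t => ?_) (fun v hv => bellmanDiff_mem_symVec Γ hv) (fun v _ => ?_)
    (vec_mem_symVec.2 hHs) hcost hb hB (g := c * τ / 4) (by positivity) (fun u hu => ?_) hD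
    (fun p q => ?_) ?_
  · change frobNorm (H - unvec _) ≤ _
    rw [frobNorm_sub_unvec]
    set e := vecNorm (pinv ((featureMatrix y τ)ᵀ * (featureMatrix y τ -
      featureMatrix (fun t => y (t + 1)) τ + Matrix.of fun _ => vec W)) *ᵥ
        ((featureMatrix y τ)ᵀ *ᵥ fun t : Fin τ => lqCost M N (y t) (linPolicy K (y t))) - vec H)
      with he
    have he0 : 0 ≤ e := vecNorm_nonneg _
    change e ≤ _
    have h1 : c * b * τ / 8 * e ≤ D * k2 * vecNorm (vec H) := by
      refine le_trans ?_ main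
      refine mul_le_mul_of_nonneg_right ?_ he0
      linarith
    rw [div_mul_div_comm, le_div_iff₀ (by positivity)]
    nlinarith
  · change featureMatrix y τ t - featureMatrix (fun t => y (t + 1)) τ t + vec W ∈ symVec n
    rw [featureMatrix_row, featureMatrix_row]
    exact (symVec n).add_mem ((symVec n).sub_mem (quadFeature_mem_symVec _)
      (quadFeature_mem_symVec _)) (vec_mem_symVec.2 hWs)
  · funext t
    rw [Matrix.add_mulVec, Matrix.sub_mulVec, Pi.add_apply, Pi.sub_apply, Pi.sub_apply, hrow, hrow,
      hrow, quadFeature_dotProduct_bellmanDiff]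
    have h1 : (Ξ *ᵥ v) t = quadFeature (y (t + 1)) ⬝ᵥ v - quadFeature (Γ *ᵥ y t) ⬝ᵥ v
        - vec W ⬝ᵥ v := by
      rw [← sub_dotProduct, ← sub_dotProduct]
      rfl
    have h2 : ((Matrix.of fun _ : Fin τ => vec W) *ᵥ v) t = vec W ⬝ᵥ v := rfl
    rw [h1, h2]
    ring
  · obtain ⟨m, rfl⟩ : ∃ m, τ = m + 1 := ⟨τ - 1, by omega⟩
    have h1 := gram_lower_bound hgram hy hgr hu
    have h2 : (featureMatrix y (m + 1) *ᵥ u) ⬝ᵥ (featureMatrix y (m + 1) *ᵥ u)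
        = ∑ t ∈ Finset.range (m + 1), (quadFeature (y t) ⬝ᵥ u) ^ 2 := by
      rw [dotProduct, Finset.sum_range]
      exact Finset.sum_congr rfl fun t _ => by rw [hrow, sq]
    rw [h2]
    refine le_trans (mul_le_mul_of_nonneg_right ?_ (dotProduct_self_nonneg u)) h1
    simp only [Nat.add_sub_cancel]
    push_cast at *
    nlinarith
  · have : ((featureMatrix y τ)ᵀ * Ξ) p q
        = ∑ t ∈ Finset.range τ, noiseTerm Γ W p q (y t) (z t) := by
      rw [Matrix.mul_apply, Finset.sum_range]
      refine Finset.sum_congr rfl fun t _ => ?_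
      rw [Matrix.transpose_apply, featureMatrix_row, noiseTerm, ← hy]
      rfl
    rw [this]
    exact hnoise p q
  · have : 0 < c * b * τ := by positivity
    nlinarith

end Deterministic

/-! ### The centred terms satisfy the growth conditions of the deviation bound -/

section Terms

variable {n : ℕ} {Γ W : Matrix (Fin n) (Fin n) ℝ}

theorem measurable_noiseTerm (p q : Fin n × Fin n) :
    Measurable (Function.uncurry (noiseTerm Γ W p q)) := by
  have h : Continuous fun a : (Fin n → ℝ) × EuclideanSpace ℝ (Fin n) => Γ *ᵥ a.1 + a.2.ofLp := by
    fun_prop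
  have h' : Continuous fun a : (Fin n → ℝ) × EuclideanSpace ℝ (Fin n) => Γ *ᵥ a.1 := by
    fun_prop
  exact (((continuous_quadFeature p).comp continuous_fst).mul
    ((((continuous_quadFeature q).comp h).sub ((continuous_quadFeature q).comp h')).sub
      continuous_const)).measurable

theorem measurable_gramTerm (p q : Fin n × Fin n) :
    Measurable (Function.uncurry (gramTerm Γ W p q)) := by
  have h := (continuous_quarticWeight_mul_quadFeature Γ p q).measurable
  have h2 := (h.stronglyMeasurable.integral_prod_right' (ν := multivariateGaussian 0 W)).measurable
  exact h.sub (h2.comp measurable_fst)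

theorem quadFeature_add_sub (μ x : Fin n → ℝ) (q : Fin n × Fin n) :
    quadFeature (μ + x) q - quadFeature μ q = μ q.1 * x q.2 + x q.1 * μ q.2 + x q.1 * x q.2 := by
  simp only [quadFeature, Pi.add_apply]
  ring

theorem integral_noiseTerm (hW : W.PosSemidef) (p q : Fin n × Fin n) (x : Fin n → ℝ) :
    ∫ z, noiseTerm Γ W p q x z ∂(multivariateGaussian 0 W) = 0 := by
  have hWs : W q.1 q.2 = W q.2 q.1 := by
    have : Wᵀ = W := by
      simpa [Matrix.IsHermitian, Matrix.conjTranspose_eq_transpose_of_trivial] using hW.1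
    exact congrFun (congrFun this q.2) q.1
  simp only [noiseTerm]
  rw [integral_const_mul]
  simp only [quadFeature_add_sub]
  have i1 := (integrable_coord_multivariateGaussian (W := W) q.2).const_mul ((Γ *ᵥ x) q.1)
  have i2 := (integrable_coord_multivariateGaussian (W := W) q.1).mul_const ((Γ *ᵥ x) q.2)
  have i3 := integrable_coord_mul_coord_multivariateGaussian (W := W) q.1 q.2
  have i12 : Integrable (fun z : EuclideanSpace ℝ (Fin n) =>
      (Γ *ᵥ x) q.1 * z.ofLp q.2 + z.ofLp q.1 * (Γ *ᵥ x) q.2) (multivariateGaussian 0 W) := i1.add i2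
  have i123 : Integrable (fun z : EuclideanSpace ℝ (Fin n) =>
      (Γ *ᵥ x) q.1 * z.ofLp q.2 + z.ofLp q.1 * (Γ *ᵥ x) q.2 + z.ofLp q.1 * z.ofLp q.2)
      (multivariateGaussian 0 W) := i12.add i3
  rw [integral_sub i123 (integrable_const _), integral_add i12 i3, integral_add i1 i2,
    integral_const_mul, integral_mul_const, integral_coord_multivariateGaussian,
    integral_coord_multivariateGaussian, integral_coord_mul_coord_multivariateGaussian hW]
  simp [vec, hWs]

theorem integral_gramTerm (p q : Fin n × Fin n) (x : Fin n → ℝ) :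
    ∫ z, gramTerm Γ W p q x z ∂(multivariateGaussian 0 W) = 0 := by
  simp only [gramTerm]
  rw [integral_sub (integrable_quarticWeight_mul_quadFeature Γ W x p q) (integrable_const _)]
  simp

theorem abs_noiseTerm_le {N : (Fin n → ℝ) → ℝ} (hN : ∀ x, ‖x‖ ≤ N x) (hNΓ : ∀ x, N (Γ *ᵥ x) ≤ N x)
    (p q : Fin n × Fin n) (x : Fin n → ℝ) (z : EuclideanSpace ℝ (Fin n)) :
    |noiseTerm Γ W p q x z| ≤ (1 + N x) ^ 4 * (2 + |vec W q| + 2 * ‖z‖ ^ 2) := by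
  have hx0 := norm_nonneg x
  have hμ : ‖Γ *ᵥ x‖ ≤ N x := (hN _).trans (hNΓ x)
  have hNx := hN x
  have hNp : 0 ≤ N x := hx0.trans hNx
  have hz0 := norm_nonneg z
  set μ := Γ *ᵥ x with hμd
  have hc : ∀ i, |μ i| ≤ N x := fun i => (norm_le_pi_norm μ i).trans hμ
  have hzc := abs_coord_le z
  have h1 : |quadFeature (μ + z.ofLp) q - quadFeature μ q - vec W q|
      ≤ (1 + N x) ^ 2 * (2 + |vec W q| + 2 * ‖z‖ ^ 2) := by
    rw [quadFeature_add_sub]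
    have e1 : |μ q.1 * z q.2| ≤ N x * ‖z‖ := by
      rw [abs_mul]
      gcongr
      exacts [hc _, hzc _]
    have e2 : |z q.1 * μ q.2| ≤ ‖z‖ * N x := by
      rw [abs_mul]
      gcongr
      exacts [hzc _, hc _]
    have e3 : |z q.1 * z q.2| ≤ ‖z‖ * ‖z‖ := by
      rw [abs_mul]
      gcongr
      exacts [hzc _, hzc _]
    have e4 := abs_sub (μ q.1 * z q.2 + z q.1 * μ q.2 + z q.1 * z q.2) (vec W q)
    have e5 := abs_add_le (μ q.1 * z q.2 + z q.1 * μ q.2) (z q.1 * z q.2)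
    have e6 := abs_add_le (μ q.1 * z q.2) (z q.1 * μ q.2)
    have e7 : (1 + N x) * (2 + |vec W q| + 2 * ‖z‖ ^ 2) ≤
        (1 + N x) ^ 2 * (2 + |vec W q| + 2 * ‖z‖ ^ 2) := by
      have := abs_nonneg (vec W q)
      gcongr
      nlinarith
    have e8 : 2 * (N x * ‖z‖) ≤ N x * (2 + 2 * ‖z‖ ^ 2) := by
      nlinarith [mul_nonneg hNp (sq_nonneg (‖z‖ - 1)), mul_nonneg hNp (sq_nonneg ‖z‖)]
    have e9 := mul_nonneg hNp (abs_nonneg (vec W q))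
    nlinarith [sq_nonneg ‖z‖]
  have h2 : |quadFeature x p| ≤ (1 + N x) ^ 2 :=
    (abs_quadFeature_le x p).trans (pow_le_pow_left₀ hx0 (by linarith) 2)
  rw [noiseTerm, abs_mul]
  calc _ ≤ (1 + N x) ^ 2 * ((1 + N x) ^ 2 * (2 + |vec W q| + 2 * ‖z‖ ^ 2)) := by gcongr
    _ = _ := by ring

theorem abs_gramTerm_le {N : (Fin n → ℝ) → ℝ} (hN : ∀ x, ‖x‖ ≤ N x) (hNΓ : ∀ x, N (Γ *ᵥ x) ≤ N x)
    (p q : Fin n × Fin n) (x : Fin n → ℝ) (z : EuclideanSpace ℝ (Fin n)) :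
    |gramTerm Γ W p q x z| ≤ (1 + N x) ^ 4 * 2 := by
  have hμ : ‖Γ *ᵥ x‖ ≤ N x := (hN _).trans (hNΓ x)
  have h1 : (1 + ‖Γ *ᵥ x‖) ^ 4 ≤ (1 + N x) ^ 4 := by gcongr
  have h2 := abs_quarticWeight_mul_quadFeature_le (Γ *ᵥ x) z p q
  have h3 := norm_integral_le_of_norm_le_const (μ := multivariateGaussian 0 W)
    (f := fun z => quarticWeight z * (quadFeature (Γ *ᵥ x + z.ofLp) p *
      quadFeature (Γ *ᵥ x + z.ofLp) q)) (C := (1 + ‖Γ *ᵥ x‖) ^ 4)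
    (Eventually.of_forall fun z => abs_quarticWeight_mul_quadFeature_le (Γ *ᵥ x) z p q)
  rw [Real.norm_eq_abs, probReal_univ, mul_one] at h3
  rw [gramTerm]
  refine (abs_sub _ _).trans ?_
  linarith

end Terms

/-! ### The state process -/

section States

variable {n d : ℕ} (A : Matrix (Fin n) (Fin n) ℝ) (B : Matrix (Fin n) (Fin d) ℝ)
  (K : Matrix (Fin d) (Fin n) ℝ)

theorem lqState_succ (x0 : EuclideanSpace ℝ (Fin n)) (w : ℕ → EuclideanSpace ℝ (Fin n)) (t : ℕ) :
    lqState A B K x0 w (t + 1) = (A - B * K) *ᵥ lqState A B K x0 w t + (w (t + 1)).ofLp := by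
  rw [lqState, linPolicy, Matrix.mulVec_neg, Matrix.mulVec_mulVec, ← sub_eq_add_neg,
    ← Matrix.sub_mulVec]

/-- The state at time `t` depends only on the noise up to time `t`. -/
theorem lqState_congr (x0 : EuclideanSpace ℝ (Fin n)) {w w' : ℕ → EuclideanSpace ℝ (Fin n)} {t : ℕ}
    (h : ∀ j ≤ t, w j = w' j) : lqState A B K x0 w t = lqState A B K x0 w' t := by
  induction t with
  | zero => rfl
  | succ t ih =>
    rw [lqState_succ, lqState_succ, ih fun j hj => h j (by omega), h (t + 1) le_rfl]

theorem measurable_lqState (t : ℕ) :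
    Measurable fun a : EuclideanSpace ℝ (Fin n) × (ℕ → EuclideanSpace ℝ (Fin n)) =>
      lqState A B K a.1 a.2 t := by
  induction t with
  | zero =>
    simp only [lqState]
    fun_prop
  | succ t ih =>
    simp only [lqState_succ]
    have h : Continuous fun y : Fin n → ℝ => (A - B * K) *ᵥ y := by fun_prop
    refine (h.measurable.comp ih).add ?_
    fun_prop

end States

theorem indepFun_prodMk_left {Ω α β γ : Type*} [MeasurableSpace Ω] [MeasurableSpace α]
    [MeasurableSpace β] [MeasurableSpace γ] {P : Measure Ω} [IsProbabilityMeasure P] {x : Ω → α}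
    {a : Ω → β} {b : Ω → γ} (hx : Measurable x) (ha : Measurable a) (hb : Measurable b)
    (h1 : IndepFun x (fun ω => (a ω, b ω)) P) (h2 : IndepFun a b P) :
    IndepFun (fun ω => (x ω, a ω)) b P := by
  have := Measure.isProbabilityMeasure_map (μ := P) hx.aemeasurable
  have := Measure.isProbabilityMeasure_map (μ := P) ha.aemeasurable
  have := Measure.isProbabilityMeasure_map (μ := P) hb.aemeasurable
  have h3 : IndepFun x a P := h1.comp measurable_id measurable_fst
  rw [indepFun_iff_map_prod_eq_prod_map_map (hx.prodMk ha).aemeasurable hb.aemeasurable,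
    (indepFun_iff_map_prod_eq_prod_map_map hx.aemeasurable ha.aemeasurable).1 h3]
  have h4 := (indepFun_iff_map_prod_eq_prod_map_map hx.aemeasurable
    (ha.prodMk hb).aemeasurable).1 h1
  rw [(indepFun_iff_map_prod_eq_prod_map_map ha.aemeasurable hb.aemeasurable).1 h2,
    ← Measure.prodAssoc_prod] at h4
  have h5 := congrArg (Measure.map MeasurableEquiv.prodAssoc.symm) h4
  rw [Measure.map_map MeasurableEquiv.prodAssoc.symm.measurable (hx.prodMk (ha.prodMk hb)),
    Measure.map_map MeasurableEquiv.prodAssoc.symm.measurable MeasurableEquiv.prodAssoc.measurable,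
    MeasurableEquiv.symm_comp_self, Measure.map_id] at h5
  exact h5

/-- The initial state and the noise up to time `m` are independent of the noise at time `m + 1`. -/
theorem indepFun_history {Ω E : Type*} [MeasurableSpace Ω] [MeasurableSpace E] [Zero E]
    {P : Measure Ω} [IsProbabilityMeasure P] {x0 : Ω → E} {w : ℕ → Ω → E} (hx0 : Measurable x0)
    (hw : ∀ t, Measurable (w t)) (hi : iIndepFun w P) (h0 : IndepFun x0 (fun ω t => w t ω) P)
    (m : ℕ) :
    IndepFun (fun ω => (x0 ω, fun j => if j ≤ m then w j ω else 0)) (w (m + 1)) P := by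
  have hφ : Measurable fun v : ℕ → E => fun j => if j ≤ m then v j else 0 := by
    refine measurable_pi_lambda _ fun j => ?_
    split_ifs
    · exact measurable_pi_apply j
    · exact measurable_const
  have hwm : Measurable fun ω t => w t ω := measurable_pi_lambda _ hw
  refine indepFun_prodMk_left hx0 (hφ.comp hwm) (hw _)
    (h0.comp measurable_id (hφ.prodMk (measurable_pi_apply (m + 1)))) ?_
  have h1 := hi.indepFun_finset (Finset.range (m + 1)) {m + 1} (by simp) hw
  have hψ : Measurable fun v : Finset.range (m + 1) → E =>
      fun j => if h : j ∈ Finset.range (m + 1) then v ⟨j, h⟩ else 0 := by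
    refine measurable_pi_lambda _ fun j => ?_
    split_ifs
    · exact measurable_pi_apply _
    · exact measurable_const
  have h2 := h1.comp hψ (measurable_pi_apply ⟨m + 1, Finset.mem_singleton_self _⟩)
  have e : (fun ω j => if j ≤ m then w j ω else 0) =
      (fun (v : Finset.range (m + 1) → E) j =>
        if h : j ∈ Finset.range (m + 1) then v ⟨j, h⟩ else 0) ∘ fun ω i => w i ω := by
    funext ω j
    by_cases h : j ≤ m <;> simp [h]
  rw [e]
  exact h2

theorem pastIndep_lqState {Ω : Type*} [MeasurableSpace Ω] {P : Measure Ω} [IsProbabilityMeasure P]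
    {n d : ℕ} (A : Matrix (Fin n) (Fin n) ℝ) (B : Matrix (Fin n) (Fin d) ℝ)
    (K : Matrix (Fin d) (Fin n) ℝ) {x0 : Ω → EuclideanSpace ℝ (Fin n)}
    {w : ℕ → Ω → EuclideanSpace ℝ (Fin n)} (hx0 : Measurable x0) (hw : ∀ t, Measurable (w t))
    (hi : iIndepFun w P) (h0 : IndepFun x0 (fun ω t => w t ω) P) (s : ℕ) :
    PastIndep (fun k ω => lqState A B K (x0 ω) (fun t => w t ω) (s + k))
      (fun k => w (s + k + 1)) P := by
  intro k
  have hφ : Measurable fun a : EuclideanSpace ℝ (Fin n) × (ℕ → EuclideanSpace ℝ (Fin n)) =>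
      (lqState A B K a.1 a.2 (s + k),
        fun t : Fin k => (lqState A B K a.1 a.2 (s + t), a.2 (s + t + 1))) := by
    refine (measurable_lqState A B K _).prodMk (measurable_pi_lambda _ fun t =>
      (measurable_lqState A B K _).prodMk ?_)
    fun_prop
  have h := (indepFun_history hx0 hw hi h0 (s + k)).comp hφ measurable_id
  have e : (fun ω => (lqState A B K (x0 ω) (fun t => w t ω) (s + k), fun t : Fin k =>
      (lqState A B K (x0 ω) (fun t => w t ω) (s + t), w (s + t + 1) ω)))
      = (fun a : EuclideanSpace ℝ (Fin n) × (ℕ → EuclideanSpace ℝ (Fin n)) =>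
      (lqState A B K a.1 a.2 (s + k),
        fun t : Fin k => (lqState A B K a.1 a.2 (s + t), a.2 (s + t + 1)))) ∘
        fun ω => (x0 ω, fun j => if j ≤ s + k then w j ω else 0) := by
    funext ω
    have hc : ∀ t ≤ k, lqState A B K (x0 ω) (fun t => w t ω) (s + t)
        = lqState A B K (x0 ω) (fun j => if j ≤ s + k then w j ω else 0) (s + t) := fun t ht =>
      lqState_congr A B K _ fun j hj => by rw [if_pos (by omega)]
    refine Prod.ext (hc k le_rfl) (funext fun t => Prod.ext (hc t t.2.le) ?_)
    simp
  rw [e]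
  exact h

/-! ### The LSTD error with high probability -/

section HighProbability

variable {n d : ℕ} {A : Matrix (Fin n) (Fin n) ℝ} {B : Matrix (Fin n) (Fin d) ℝ}
  {K : Matrix (Fin d) (Fin n) ℝ} {M : Matrix (Fin n) (Fin n) ℝ} {N : Matrix (Fin d) (Fin d) ℝ}
  {W Sigma0 H : Matrix (Fin n) (Fin n) ℝ}

/-- The sums of all centred terms along a stretch of the trajectory are of order `√k` up to
logarithms, uniformly in the time `s` at which the stretch starts. -/
theorem exists_terms_deviation_bound (hΓ : IsStable (A - B * K)) (hW : W.PosDef) :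
    ∃ D : ℝ, 0 < D ∧ ∀ (Ω : Type u) [MeasurableSpace Ω] (P : Measure Ω) [IsProbabilityMeasure P]
      (x0 : Ω → EuclideanSpace ℝ (Fin n)) (w : ℕ → Ω → EuclideanSpace ℝ (Fin n)),
      Measurable x0 → (∀ t, Measurable (w t)) → P.map x0 = multivariateGaussian 0 Sigma0 →
      (∀ t, P.map (w t) = multivariateGaussian 0 W) → iIndepFun w P →
      IndepFun x0 (fun ω t => w t ω) P → ∀ (s k : ℕ) (δ : ℝ), 3 ≤ k → 0 < δ → δ < 1 →
      ∃ E : Set Ω, MeasurableSet E ∧ 1 - δ ≤ P.real E ∧ ∀ ω ∈ E, ∀ p q,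
        |∑ t ∈ Finset.range k, noiseTerm (A - B * K) W p q
            (lqState A B K (x0 ω) (fun t => w t ω) (s + t)) (w (s + t + 1) ω)|
          ≤ D * √k * Real.log (k / δ) ^ 5 ∧
        |∑ t ∈ Finset.range k, gramTerm (A - B * K) W p q
            (lqState A B K (x0 ω) (fun t => w t ω) (s + t)) (w (s + t + 1) ω)|
          ≤ D * √k * Real.log (k / δ) ^ 5 := by
  set Γ := A - B * K with hΓd
  obtain ⟨V, r, C, hr0, hr1, hC0, hVc, hVΓ, hVadd, hVn, hVC⟩ := exists_adapted_norm hΓ.tendsto_pow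
  have hV0 : ∀ x, 0 ≤ V x := fun x => (norm_nonneg x).trans (hVn x)
  have hVΓ' : ∀ x, V (Γ *ᵥ x) ≤ V x := fun x => (hVΓ x).trans (by nlinarith [hV0 x])
  have h1r : 0 < 1 - r := by linarith
  set ν := multivariateGaussian (0 : EuclideanSpace ℝ (Fin n)) W with hν
  obtain ⟨ε, hε, hεi⟩ := IsGaussian.exists_integrable_exp_sq ν
  set c0 : ℝ := 2 + ∑ q, |vec W q| with hc0
  have hWq : ∀ q, |vec W q| ≤ ∑ q, |vec W q| := fun q =>
    Finset.single_le_sum (f := fun q => |vec W q|) (fun _ _ => abs_nonneg _) (Finset.mem_univ q)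
  have hsum0 : 0 ≤ ∑ q, |vec W q| := Finset.sum_nonneg fun _ _ => abs_nonneg _
  set g : EuclideanSpace ℝ (Fin n) → ℝ := fun z => c0 + 2 * ‖z‖ ^ 2 with hg
  have hgi : Integrable (fun z => Real.exp (2 * (ε / 4 * g z))) ν := by
    have : (fun z => Real.exp (2 * (ε / 4 * g z)))
        = fun z => Real.exp (ε * c0 / 2) * Real.exp (ε * ‖z‖ ^ 2) := by
      funext z
      rw [← Real.exp_add, hg]
      congr 1
      ring
    rw [this]
    exact hεi.const_mul _
  set I0 : ℝ := ∫ x, Real.exp (C * ‖x‖)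
    ∂(multivariateGaussian (0 : EuclideanSpace ℝ (Fin n)) Sigma0)
  set I1 : ℝ := ∫ x, Real.exp (C / (1 - r) * ‖x‖) ∂ν
  set F : ((Fin n × Fin n) × (Fin n × Fin n)) ⊕ ((Fin n × Fin n) × (Fin n × Fin n)) →
      (Fin n → ℝ) → EuclideanSpace ℝ (Fin n) → ℝ :=
    Sum.elim (fun a => noiseTerm Γ W a.1 a.2) (fun a => gramTerm Γ W a.1 a.2) with hF
  obtain ⟨D, hD, h⟩ := exists_deviation_bound.{u} ν hVc.measurable hV0 (F := F)
    (by
      rintro (a | a)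
      · exact measurable_noiseTerm _ _
      · exact measurable_gramTerm _ _)
    (by
      rintro (a | a) x
      · exact integral_noiseTerm hW.posSemidef _ _ _
      · exact integral_gramTerm _ _ _)
    (g := g) (fun z => by rw [hg]; positivity)
    (by
      rintro (a | a) x z
      · refine (abs_noiseTerm_le hVn hVΓ' a.1 a.2 x z).trans ?_
        have := hV0 x
        have := hWq a.2
        simp only [hg, hc0]
        gcongr
      · refine (abs_gramTerm_le hVn hVΓ' a.1 a.2 x z).trans ?_
        have := hV0 x
        simp only [hg, hc0]
        gcongr
        nlinarith [sq_nonneg ‖z‖])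
    (θ := ε / 4) (by positivity) hgi (C := max 1 (max I0 I1)) (le_max_left _ _)
  refine ⟨D, hD, fun Ω _ P _ x0 w hx0 hw hlaw0 hlaw hi h0 s k δ hk hδ0 hδ1 => ?_⟩
  have hXm : ∀ t, Measurable fun ω => lqState A B K (x0 ω) (fun t => w t ω) t := fun t =>
    (measurable_lqState A B K t).comp (hx0.prodMk (measurable_pi_lambda _ hw))
  have hexp : ∀ (μ : Measure (EuclideanSpace ℝ (Fin n))) [IsGaussian μ]
      (x : Ω → EuclideanSpace ℝ (Fin n)) (b a : ℝ), Measurable x → P.map x = μ → 0 < a →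
      b = C / a → ∫⁻ ω, ENNReal.ofReal (Real.exp (V (x ω).ofLp / a)) ∂P
        ≤ ENNReal.ofReal (∫ x, Real.exp (b * ‖x‖) ∂μ) := by
    intro μ _ x b a hx hμ ha hb
    have hm : Measurable fun x : EuclideanSpace ℝ (Fin n) =>
        ENNReal.ofReal (Real.exp (b * ‖x‖)) := by
      fun_prop
    rw [ofReal_integral_eq_lintegral_ofReal (integrable_exp_mul_norm μ b)
      (Eventually.of_forall fun x => (Real.exp_pos _).le), ← hμ, lintegral_map hm hx]
    refine lintegral_mono fun ω => ENNReal.ofReal_le_ofReal (Real.exp_le_exp.2 ?_)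
    rw [hb, div_mul_eq_mul_div]
    gcongr
    exact (hVC _).trans (mul_le_mul_of_nonneg_left (norm_ofLp_le _) hC0)
  have hmom := lintegral_exp_le_of_contraction (P := P)
    (ξ := fun t ω => V (lqState A B K (x0 ω) (fun t => w t ω) t))
    (ζ := fun t ω => V (w (t + 1) ω).ofLp) (C := max 1 (max I0 I1))
    (fun t => hVc.measurable.comp
      ((WithLp.measurable_ofLp 2 _).comp (hw (t + 1)))) hr0.le hr1
    (fun t ω => by
      dsimp only
      rw [lqState_succ]
      exact (hVadd _ _).trans (add_le_add_left (hVΓ _) _))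
    (by
      have := hexp _ x0 C 1 hx0 hlaw0 one_pos (div_one C).symm
      simp only [div_one] at this
      exact this.trans (ENNReal.ofReal_le_ofReal ((le_max_left _ _).trans (le_max_right _ _))))
    (fun t => (hexp _ (w (t + 1)) (C / (1 - r)) (1 - r) (hw _) (hlaw _) h1r rfl).trans
      (ENNReal.ofReal_le_ofReal ((le_max_right _ _).trans (le_max_right _ _))))
  obtain ⟨E, hE, hPE, hb⟩ := h Ω P (fun t ω => lqState A B K (x0 ω) (fun t => w t ω) (s + t))
    (fun t => w (s + t + 1)) (fun t => hXm _) (fun t => hw _) (fun t => hlaw _)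
    (pastIndep_lqState A B K hx0 hw hi h0 s) (fun t => hmom _) k δ hk hδ0 hδ1
  exact ⟨E, hE, hPE, fun ω hω p q => ⟨hb ω hω (Sum.inl (p, q)), hb ω hω (Sum.inr (p, q))⟩⟩

theorem exists_lstd_bound_of_measurable (hΓ : IsStable (A - B * K)) (hW : W.PosDef) (hHs : Hᵀ = H)
    (hH : H = (A - B * K)ᵀ * H * (A - B * K) + (M + Kᵀ * N * K)) :
    ∃ D : ℝ, 0 < D ∧ ∀ (Ω : Type u) [MeasurableSpace Ω] (P : Measure Ω) [IsProbabilityMeasure P]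
      (x0 : Ω → EuclideanSpace ℝ (Fin n)) (w : ℕ → Ω → EuclideanSpace ℝ (Fin n)),
      Measurable x0 → (∀ t, Measurable (w t)) → P.map x0 = multivariateGaussian 0 Sigma0 →
      (∀ t, P.map (w t) = multivariateGaussian 0 W) → iIndepFun w P →
      IndepFun x0 (fun ω t => w t ω) P → ∀ (s τ : ℕ) (δ : ℝ), 4 ≤ τ → 0 < δ → δ < 1 →
      D * Real.log (τ / δ) ^ 5 ≤ √τ → ∃ E : Set Ω, MeasurableSet E ∧ 1 - δ ≤ P.real E ∧ ∀ ω ∈ E,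
        frobNorm (H - lstd K M N W
          (fun t => lqState A B K (x0 ω) (fun t => w t ω) (s + t)) τ)
            ≤ D * (Real.log (τ / δ) ^ 5 / √τ) := by
  obtain ⟨D, hD, h⟩ := exists_terms_deviation_bound.{u} (Sigma0 := Sigma0) hΓ hW
  obtain ⟨κ, hκ, a, ha, hdet⟩ := exists_lstd_error_bound (M := M) (N := N) (K := K) hΓ hW hHs hH
  refine ⟨max (32 * D / κ) (a * (32 * D)), by positivity, ?_⟩
  intro Ω _ P _ x0 w hx0 hw hlaw0 hlaw hi h0 s τ δ hτ hδ0 hδ1 hsmall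
  have hτ4 : (4 : ℝ) ≤ τ := by exact_mod_cast hτ
  have hτ0 : (0 : ℝ) < τ := by linarith
  have hsτ : 0 < √(τ : ℝ) := Real.sqrt_pos.2 hτ0
  obtain ⟨E1, hE1, hP1, hb1⟩ := h Ω P x0 w hx0 hw hlaw0 hlaw hi h0 s τ (δ / 2) (by omega)
    (by positivity) (by linarith)
  obtain ⟨E2, hE2, hP2, hb2⟩ := h Ω P x0 w hx0 hw hlaw0 hlaw hi h0 s (τ - 1) (δ / 2) (by omega)
    (by positivity) (by linarith)
  set L := Real.log (τ / δ) with hL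
  have hL0 : 0 ≤ L := Real.log_nonneg (by rw [le_div_iff₀ hδ0]; linarith)
  -- the logarithms for `δ / 2` are at most twice those for `δ`
  have hlog : ∀ m : ℕ, 3 ≤ m → m ≤ τ →
      D * √m * Real.log (m / (δ / 2)) ^ 5 ≤ 32 * D * (√τ * L ^ 5) := by
    intro m hm3 hm
    have hm3' : (3 : ℝ) ≤ m := by exact_mod_cast hm3
    have hm' : (m : ℝ) ≤ τ := by exact_mod_cast hm
    have h1 : Real.log (m / (δ / 2)) ≤ 2 * L := by
      rw [hL, ← Real.log_rpow (by positivity) 2]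
      refine Real.log_le_log (by positivity) ?_
      rw [Real.rpow_two, div_div_eq_mul_div, div_pow, div_le_div_iff₀ hδ0 (by positivity)]
      have e1 : m * 2 * δ ≤ τ * τ := by nlinarith
      calc m * 2 * δ ^ 2 = m * 2 * δ * δ := by ring
        _ ≤ τ * τ * δ := by gcongr
        _ = τ ^ 2 * δ := by ring
    have h2 : 0 ≤ Real.log (m / (δ / 2)) :=
      Real.log_nonneg (by rw [le_div_iff₀ (by positivity)]; linarith)
    calc D * √m * Real.log (m / (δ / 2)) ^ 5 ≤ D * √τ * (2 * L) ^ 5 := by gcongr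
      _ = _ := by ring
  refine ⟨E1 ∩ E2, hE1.inter hE2, ?_, fun ω hω => ?_⟩
  · have h1 := probReal_compl_eq_one_sub (μ := P) hE1
    have h2 := probReal_compl_eq_one_sub (μ := P) hE2
    have h3 := probReal_compl_eq_one_sub (μ := P) (hE1.inter hE2)
    have h4 := measureReal_union_le (μ := P) E1ᶜ E2ᶜ
    rw [← Set.compl_inter] at h4
    linarith
  · have h1 := hdet (fun t => lqState A B K (x0 ω) (fun t => w t ω) (s + t))
      (fun t => w (s + t + 1) ω) (fun t => lqState_succ A B K _ _ _) τ (32 * D * (√τ * L ^ 5))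
      (by omega) (by positivity) ?_
      (fun p q => (hb1 ω hω.1 p q).1.trans (hlog τ (by omega) le_rfl))
      (fun p q => (hb2 ω hω.2 p q).2.trans (hlog (τ - 1) (by omega) (by omega)))
    · refine h1.trans ?_
      have e : a * (32 * D * (√τ * L ^ 5) / τ) = a * (32 * D) * (L ^ 5 / √τ) := by
        have : (τ : ℝ) = √τ ^ 2 := (Real.sq_sqrt hτ0.le).symm
        field_simp
        rw [← this]
        ring
      rw [e]
      gcongr
      exact le_max_right _ _
    · have e1 : 32 * D / κ * L ^ 5 ≤ √τ :=
        le_trans (mul_le_mul_of_nonneg_right (le_max_left _ _) (by positivity)) hsmall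
      rw [div_mul_eq_mul_div, div_le_iff₀ hκ] at e1
      have e2 := mul_le_mul_of_nonneg_right e1 hsτ.le
      have : √(τ : ℝ) * √τ = τ := Real.mul_self_sqrt hτ0.le
      calc 32 * D * (√τ * L ^ 5) = 32 * D * L ^ 5 * √τ := by ring
        _ ≤ √τ * κ * √τ := e2
        _ = κ * (√τ * √τ) := by ring
        _ = κ * τ := by rw [this]

/-- The measurability assumption is removed by passing to measurable modifications of the initial
state and the noise. -/
theorem exists_lstd_bound (hΓ : IsStable (A - B * K)) (hW : W.PosDef) (hHs : Hᵀ = H)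
    (hH : H = (A - B * K)ᵀ * H * (A - B * K) + (M + Kᵀ * N * K)) :
    ∃ D : ℝ, 0 < D ∧ ∀ (Ω : Type u) [MeasurableSpace Ω] (P : Measure Ω) [IsProbabilityMeasure P]
      (x0 : Ω → EuclideanSpace ℝ (Fin n)) (w : ℕ → Ω → EuclideanSpace ℝ (Fin n)),
      HasLaw x0 (multivariateGaussian 0 Sigma0) P →
      (∀ t, HasLaw (w t) (multivariateGaussian 0 W) P) → iIndepFun w P →
      IndepFun x0 (fun ω t => w t ω) P → ∀ (s τ : ℕ) (δ : ℝ), 4 ≤ τ → 0 < δ → δ < 1 →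
      D * Real.log (τ / δ) ^ 5 ≤ √τ → ∃ E : Set Ω, MeasurableSet E ∧ 1 - δ ≤ P.real E ∧ ∀ ω ∈ E,
        frobNorm (H - lstd K M N W
          (fun t => lqState A B K (x0 ω) (fun t => w t ω) (s + t)) τ)
            ≤ D * (Real.log (τ / δ) ^ 5 / √τ) := by
  obtain ⟨D, hD, h⟩ := exists_lstd_bound_of_measurable.{u} (Sigma0 := Sigma0) hΓ hW hHs hH
  refine ⟨D, hD, fun Ω _ P _ x0 w hlaw0 hlaw hi h0 s τ δ hτ hδ0 hδ1 hsmall => ?_⟩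
  have e0 := hlaw0.aemeasurable.ae_eq_mk
  have ew := fun t => (hlaw t).aemeasurable.ae_eq_mk
  have ewall := ae_all_iff.2 ew
  set x0' := hlaw0.aemeasurable.mk x0
  set w' : ℕ → Ω → EuclideanSpace ℝ (Fin n) := fun t => (hlaw t).aemeasurable.mk (w t)
  have ew' : (fun ω t => w t ω) =ᵐ[P] fun ω t => w' t ω := by
    filter_upwards [ewall] with ω hω
    exact funext hω
  obtain ⟨E, hE, hPE, hb⟩ := h Ω P x0' w' hlaw0.aemeasurable.measurable_mk
    (fun t => (hlaw t).aemeasurable.measurable_mk)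
    ((Measure.map_congr e0).symm.trans hlaw0.map_eq)
    (fun t => (Measure.map_congr (ew t)).symm.trans (hlaw t).map_eq)
    (hi.congr ew) (h0.congr e0 ew') s τ δ hτ hδ0 hδ1 hsmall
  obtain ⟨T, hT, hTm, hTe⟩ := (e0.and ewall).exists_measurable_mem
  refine ⟨E ∩ T, hE.inter hTm, ?_, fun ω hω => ?_⟩
  · rw [measureReal_congr (inter_ae_eq_left_of_ae_eq_univ (eventuallyEq_univ.2 hT))]
    exact hPE
  · obtain ⟨h1, h2⟩ := hTe ω hω.2
    have h3 := hb ω hω.1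
    rw [h1, show (fun t => w t ω) = fun t => w' t ω from funext h2]
    exact h3

end HighProbability

/-! ### The Frobenius norm and the projection -/

section Frobenius

variable {n : ℕ}

theorem frobNorm_eq_vecNorm (X : Matrix (Fin n) (Fin n) ℝ) : frobNorm X = vecNorm (vec X) := by
  have h := frobNorm_sub_unvec X 0
  have e : X - unvec 0 = X := sub_zero X
  have e' : vecNorm (0 - vec X) = vecNorm (vec X) := by
    rw [vecNorm, zero_sub, neg_dotProduct_neg, vecNorm]
  rw [e, e'] at h
  exact h

theorem frobNorm_nonneg (X : Matrix (Fin n) (Fin n) ℝ) : 0 ≤ frobNorm X := Real.sqrt_nonneg _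

theorem abs_entry_le_frobNorm (X : Matrix (Fin n) (Fin n) ℝ) (i j : Fin n) :
    |X i j| ≤ frobNorm X := by
  rw [frobNorm_eq_vecNorm]
  exact abs_le_vecNorm (vec X) (j, i)

theorem frobNorm_eq_norm {m : Type*} [Fintype m] (X : Matrix m m ℝ) :
    frobNorm X = @norm _ Matrix.frobeniusNormedAddCommGroup.toNorm X := by
  rw [Matrix.frobenius_norm_def, frobNorm, Real.sqrt_eq_rpow]
  simp

theorem frobNorm_sub_le (X Y : Matrix (Fin n) (Fin n) ℝ) :
    frobNorm (X - Y) ≤ frobNorm X + frobNorm Y := by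
  let : NormedAddCommGroup (Matrix (Fin n) (Fin n) ℝ) := Matrix.frobeniusNormedAddCommGroup
  simp only [frobNorm_eq_norm]
  exact norm_sub_le X Y

theorem frobNorm_le_sub_add (X Y : Matrix (Fin n) (Fin n) ℝ) :
    frobNorm X ≤ frobNorm (X - Y) + frobNorm Y := by
  let : NormedAddCommGroup (Matrix (Fin n) (Fin n) ℝ) := Matrix.frobeniusNormedAddCommGroup
  simp only [frobNorm_eq_norm]
  simpa using norm_add_le (X - Y) Y

/-- Multiplication by a positive definite matrix shrinks the Frobenius norm by at most a constant
factor. -/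
theorem exists_frobNorm_le_mul {W : Matrix (Fin n) (Fin n) ℝ} (hW : W.PosDef) :
    ∃ c > 0, ∀ X : Matrix (Fin n) (Fin n) ℝ, frobNorm X ≤ c * frobNorm (W * X) := by
  obtain ⟨U, hU⟩ := hW.isUnit
  refine ⟨frobNorm (↑U⁻¹ : Matrix (Fin n) (Fin n) ℝ) + 1,
    by linarith [frobNorm_nonneg (↑U⁻¹ : Matrix (Fin n) (Fin n) ℝ)], fun X => ?_⟩
  have h1 : X = (↑U⁻¹ : Matrix (Fin n) (Fin n) ℝ) * (W * X) := by
    rw [← Matrix.mul_assoc, ← hU, U.inv_mul, Matrix.one_mul]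
  have h2 : frobNorm ((↑U⁻¹ : Matrix (Fin n) (Fin n) ℝ) * (W * X))
      ≤ frobNorm (↑U⁻¹ : Matrix (Fin n) (Fin n) ℝ) * frobNorm (W * X) := by
    simp only [frobNorm_eq_norm]
    exact Matrix.frobenius_norm_mul _ _
  rw [← h1] at h2
  linarith [frobNorm_nonneg (W * X)]

theorem projAbove_spec (M X : Matrix (Fin n) (Fin n) ℝ) : IsNearestAbove M X (projAbove M X) :=
  (exists_isNearestAbove M X).choose_spec

/-- The projection onto the convex set `{P | P ⪰ M}` does not increase the distance to a point of
this set. -/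
theorem frobNorm_sub_le_of_isNearestAbove {M X P H : Matrix (Fin n) (Fin n) ℝ}
    (hP : IsNearestAbove M X P) (hH : (H - M).PosSemidef) :
    frobNorm (H - P) ≤ frobNorm (H - X) := by
  set a := vec (X - P)
  set b := vec (H - P)
  -- the segment from `P` to `H` lies in the convex set
  have hseg : ∀ t : ℝ, 0 ≤ t → t ≤ 1 → 2 * t * (a ⬝ᵥ b) ≤ t ^ 2 * (b ⬝ᵥ b) := by
    intro t ht0 ht1
    have hY : (P + t • (H - P) - M).PosSemidef := by
      have e : P + t • (H - P) - M = (1 - t) • (P - M) + t • (H - M) := by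
        simp only [smul_sub, sub_smul, one_smul]
        abel
      rw [e]
      exact (hP.1.smul (by linarith : (0 : ℝ) ≤ 1 - t)).add (hH.smul ht0)
    have h1 := hP.2 _ hY
    have h2 : vec (X - (P + t • (H - P))) = a - t • b := by
      funext p
      simp only [a, b, vec, Matrix.sub_apply, Matrix.add_apply, Matrix.smul_apply, Pi.sub_apply,
        Pi.smul_apply, smul_eq_mul]
      ring
    rw [frobNorm_eq_vecNorm, frobNorm_eq_vecNorm, h2] at h1
    have h3 := pow_le_pow_left₀ (vecNorm_nonneg _) h1 2
    rw [vecNorm_sq, vecNorm_sq] at h3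
    simp only [sub_dotProduct, dotProduct_sub, smul_dotProduct, dotProduct_smul, smul_eq_mul,
      dotProduct_comm b a] at h3
    linarith
  have hab : a ⬝ᵥ b ≤ 0 := by
    by_contra hpos
    rw [not_le] at hpos
    have hbb := dotProduct_self_nonneg b
    have hs : 0 < a ⬝ᵥ b + b ⬝ᵥ b := by linarith
    have h1 := hseg ((a ⬝ᵥ b) / (a ⬝ᵥ b + b ⬝ᵥ b)) (by positivity)
      ((div_le_one hs).2 (by linarith))
    rw [div_pow, div_mul_eq_mul_div, mul_div_assoc', div_mul_eq_mul_div,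
      div_le_div_iff₀ hs (by positivity)] at h1
    have h2 : 0 < (a ⬝ᵥ b) ^ 2 * (a ⬝ᵥ b + b ⬝ᵥ b) := by positivity
    nlinarith
  have e : vec (H - X) = b - a := by
    funext p
    simp only [a, b, vec, Matrix.sub_apply, Pi.sub_apply]
    ring
  rw [frobNorm_eq_vecNorm, frobNorm_eq_vecNorm, e]
  refine Real.sqrt_le_sqrt ?_
  simp only [sub_dotProduct, dotProduct_sub, dotProduct_comm b a]
  linarith [dotProduct_self_nonneg a]

end Frobenius

/-! ### The value matrix and the factor in the error bound -/

section ValueMatrix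

variable {n d : ℕ} {A : Matrix (Fin n) (Fin n) ℝ} {B : Matrix (Fin n) (Fin d) ℝ}
  {K : Matrix (Fin d) (Fin n) ℝ} {M : Matrix (Fin n) (Fin n) ℝ} {N : Matrix (Fin d) (Fin d) ℝ}

/-- The value matrix solves the Lyapunov equation of the closed loop. -/
theorem valueMatrix_eq {G : Matrix (Fin n ⊕ Fin d) (Fin n ⊕ Fin d) ℝ}
    (hG : IsActionValueMatrix A B K M N G) :
    valueMatrix K G = (A - B * K)ᵀ * valueMatrix K G * (A - B * K) + (M + Kᵀ * N * K) := by
  have h1 : dynamicsBlock A B * policyBlock K = A - B * K := by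
    rw [dynamicsBlock, policyBlock, Matrix.fromCols_mul_fromRows, Matrix.mul_one, Matrix.mul_neg,
      ← sub_eq_add_neg]
  have h2 : (policyBlock K)ᵀ * fromBlocks M 0 0 N * policyBlock K = M + Kᵀ * N * K := by
    rw [Matrix.mul_assoc, policyBlock, Matrix.fromBlocks_mul_fromRows, Matrix.transpose_fromRows,
      Matrix.fromCols_mul_fromRows]
    simp [Matrix.mul_assoc]
  rw [← h2, ← h1]
  conv_lhs => rw [valueMatrix, hG]
  rw [Matrix.mul_add, Matrix.add_mul, valueMatrix, Matrix.transpose_mul]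
  simp only [Matrix.mul_assoc]

theorem transpose_eq_of_posSemidef {m : Type*} {X : Matrix m m ℝ} (hX : X.PosSemidef) :
    Xᵀ = X := by
  simpa [Matrix.IsHermitian, Matrix.conjTranspose_eq_transpose_of_trivial] using hX.1

theorem valueMatrix_sub_posSemidef {G : Matrix (Fin n ⊕ Fin d) (Fin n ⊕ Fin d) ℝ}
    (hΓ : IsStable (A - B * K)) (hM : M.PosDef) (hN : N.PosDef)
    (hG : IsActionValueMatrix A B K M N G) : (valueMatrix K G - M).PosSemidef := by
  have hK : (Kᵀ * N * K).PosSemidef := by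
    simpa [Matrix.conjTranspose_eq_transpose_of_trivial] using
      hN.posSemidef.conjTranspose_mul_mul_same K
  have h := posSemidef_sub_of_eq_conj_add hΓ.tendsto_pow (hM.posSemidef.add hK) (valueMatrix_eq hG)
  have e : valueMatrix K G - M = valueMatrix K G - (M + Kᵀ * N * K) + Kᵀ * N * K := by abel
  rw [e]
  exact h.add hK

theorem lambdaMin_pos [Nonempty (Fin n)] (hM : M.PosDef) : 0 < lambdaMin M := by
  have hs := hM.1.spectrum_real_eq_range_eigenvalues
  have hmem : sInf (spectrum ℝ M) ∈ spectrum ℝ M := by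
    rw [hs]
    exact (Set.range_nonempty _).csInf_mem (Set.finite_range _)
  rw [hs] at hmem
  obtain ⟨i, hi⟩ := hmem
  rw [lambdaMin, hs, ← hi]
  exact hM.eigenvalues_pos i

theorem opNorm_pos {X : Matrix (Fin n) (Fin n) ℝ} (hX : X ≠ 0) : 0 < opNorm X := by
  rw [opNorm, norm_pos_iff]
  exact (map_ne_zero_iff _ (Matrix.toEuclideanCLM (n := Fin n) (𝕜 := ℝ)).injective).2 hX

/-- The error bound is a positive multiple, depending on the system only, of
`L * τ^(-1/2) * ‖W Ĥ‖_F`. -/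
theorem exists_errorBound_eq {W H Γ SV : Matrix (Fin n) (Fin n) ℝ} (hM : M.PosDef) (hH : H ≠ 0)
    (hΓ : Γ ≠ 0) (hSV : SV.PosDef) : ∃ a > 0, ∀ (X : Matrix (Fin n) (Fin n) ℝ) (τ : ℕ) (L : ℝ),
      errorBound M W H X Γ SV τ L = a * (L / √τ * frobNorm (W * X)) := by
  have : Nonempty (Fin n) := by
    by_contra h
    rw [not_nonempty_iff] at h
    exact hΓ (Subsingleton.elim _ _)
  have h1 := opNorm_pos hH
  have h2 := lambdaMin_pos hM
  have h3 := hSV.trace_pos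
  have h4 : 0 < opNorm (Γ * CFC.sqrt SV) := by
    refine opNorm_pos fun h0 => hΓ ?_
    have hS : CFC.sqrt SV * CFC.sqrt SV = SV := CFC.sqrt_mul_sqrt_self SV hSV.posSemidef.nonneg
    have h5 : Γ * SV = 0 := by rw [← hS, ← Matrix.mul_assoc, h0, Matrix.zero_mul]
    obtain ⟨U, hU⟩ := hSV.isUnit
    have h6 : Γ * SV * (↑U⁻¹ : Matrix (Fin n) (Fin n) ℝ) = Γ := by
      rw [Matrix.mul_assoc, ← hU, U.mul_inv, Matrix.mul_one]
    rw [← h6, h5, Matrix.zero_mul]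
  refine ⟨opNorm H ^ 2 / lambdaMin M ^ 2 * (SV.trace * opNorm (Γ * CFC.sqrt SV)), by positivity,
    fun X τ L => ?_⟩
  have h7 : (τ : ℝ) ^ (-(1 / 2) : ℝ) = (√τ)⁻¹ := by
    rw [Real.rpow_neg (Nat.cast_nonneg _), ← Real.sqrt_eq_rpow]
  rw [errorBound, h7]
  ring

end ValueMatrix

/-- For `τ` above a threshold of the form `τ₀ (1 + log (1 / δ))^10`, the logarithm `log (τ / δ)` is
large and its fifth power is small against `√τ`. -/
theorem exists_threshold (D ℓ : ℝ) (hD : 0 < D) : ∃ τ₀ : ℝ, 4 ≤ τ₀ ∧ ∀ (τ δ : ℝ), 0 < δ → δ < 1 →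
    τ₀ ≤ τ → ℓ ≤ Real.log (τ / δ) ∧
      (τ₀ * (1 + Real.log (1 / δ)) ^ 10 ≤ τ → D * Real.log (τ / δ) ^ 5 ≤ √τ) := by
  have hlo : ∀ᶠ τ : ℝ in atTop, D ^ 2 * 2 ^ 9 * Real.log τ ^ 10 ≤ τ / 2 := by
    have h := (Real.isLittleO_pow_log_id_atTop (n := 10)).bound
      (show (0 : ℝ) < 1 / (2 * (D ^ 2 * 2 ^ 9)) by positivity)
    filter_upwards [h, eventually_ge_atTop (0 : ℝ)] with τ h1 h0
    simp only [Real.norm_eq_abs, id] at h1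
    rw [abs_of_nonneg h0] at h1
    have h2 := mul_le_mul_of_nonneg_left ((le_abs_self _).trans h1)
      (show 0 ≤ D ^ 2 * 2 ^ 9 by positivity)
    calc _ ≤ _ := h2
      _ = τ / 2 := by field_simp
  obtain ⟨T, hT⟩ := eventually_atTop.1 hlo
  refine ⟨max (max 4 T) (max (Real.exp ℓ) (D ^ 2 * 2 ^ 10)), by simp, fun τ δ hδ0 hδ1 hτ => ?_⟩
  set τ₀ := max (max 4 T) (max (Real.exp ℓ) (D ^ 2 * 2 ^ 10)) with hτ₀
  have h4 : 4 ≤ τ₀ := (le_max_left _ _).trans (le_max_left _ _)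
  have hτT : T ≤ τ := ((le_max_right _ _).trans (le_max_left _ _)).trans hτ
  have hτℓ : Real.exp ℓ ≤ τ := ((le_max_left _ _).trans (le_max_right _ _)).trans hτ
  have hτD : D ^ 2 * 2 ^ 10 ≤ τ₀ := (le_max_right _ _).trans (le_max_right _ _)
  have hτ0 : 0 < τ := by linarith
  set l := Real.log (1 / δ) with hl
  have hl0 : 0 ≤ l := Real.log_nonneg (by rw [le_div_iff₀ hδ0]; linarith)
  have hL : Real.log (τ / δ) = Real.log τ + l := by
    rw [hl, ← Real.log_mul hτ0.ne' (by positivity)]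
    congr 1
    ring
  have hlogτ : 0 ≤ Real.log τ := Real.log_nonneg (by linarith)
  rw [hL]
  refine ⟨?_, fun h => Real.le_sqrt_of_sq_le ?_⟩
  · have := (Real.le_log_iff_exp_le hτ0).2 hτℓ
    linarith
  · have h2 : D ^ 2 * 2 ^ 10 * l ^ 10 ≤ τ := by
      refine le_trans ?_ h
      gcongr
      linarith
    have h3 := add_pow_le hlogτ hl0 10
    have h4 := hT τ hτT
    calc (D * (Real.log τ + l) ^ 5) ^ 2 = D ^ 2 * (Real.log τ + l) ^ 10 := by ring
      _ ≤ D ^ 2 * (2 ^ (10 - 1) * (Real.log τ ^ 10 + l ^ 10)) := by gcongr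
      _ = D ^ 2 * 2 ^ 9 * Real.log τ ^ 10 + D ^ 2 * 2 ^ 10 * l ^ 10 / 2 := by ring
      _ ≤ τ := by linarith

end LQ

theorem mainTheorem4 :
    ∃ C : ℝ, ∃ k : ℕ, ∀ (n d : ℕ)
      (A : Matrix (Fin n) (Fin n) ℝ) (B : Matrix (Fin n) (Fin d) ℝ)
      (K : Matrix (Fin d) (Fin n) ℝ)
      (M : Matrix (Fin n) (Fin n) ℝ) (N : Matrix (Fin d) (Fin d) ℝ)
      (W Sigma0 SigmaPi : Matrix (Fin n) (Fin n) ℝ)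
      (G : Matrix (Fin n ⊕ Fin d) (Fin n ⊕ Fin d) ℝ),
      M.PosDef → N.PosDef → W.PosDef → Sigma0.PosSemidef →
      LQ.IsStable (A - B * K) → A - B * K ≠ 0 →
      LQ.IsSteadyStateCov (A - B * K) W SigmaPi →
      LQ.IsActionValueMatrix A B K M N G →
      ∃ τ₀ : ℝ, ∀ (Ω : Type u) [MeasurableSpace Ω] (P : Measure Ω) [IsProbabilityMeasure P]
        (x0 : Ω → EuclideanSpace ℝ (Fin n)) (w : ℕ → Ω → EuclideanSpace ℝ (Fin n)),
        HasLaw x0 (multivariateGaussian 0 Sigma0) P →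
        (∀ t, HasLaw (w t) (multivariateGaussian 0 W) P) →
        iIndepFun w P →
        IndepFun x0 (fun ω t => w t ω) P →
        ∀ (s τ : ℕ) (δ : ℝ), 0 < δ → δ < 1 → τ₀ ≤ τ →
          -- the states `x_s, x_{s+1}, …` from which the estimators are computed
          let y : Ω → ℕ → Fin n → ℝ :=
            fun ω t => LQ.lqState A B K (x0 ω) (fun t => w t ω) (s + t)
          let H := LQ.valueMatrix K G
          let Bd : Matrix (Fin n) (Fin n) ℝ → ℝ := fun Hhat =>
            LQ.errorBound M W H Hhat (A - B * K) (Sigma0 + SigmaPi) τ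
              (C * Real.log (τ / δ) ^ k)
          (∃ E : Set Ω, MeasurableSet E ∧ 1 - δ ≤ P.real E ∧ ∀ ω ∈ E,
            LQ.frobNorm (H - LQ.lstdProj K M N W (y ω) τ)
              ≤ Bd (LQ.lstdProj K M N W (y ω) τ)) ∧
          (τ₀ * (1 + Real.log (1 / δ)) ^ k ≤ τ →
            ∃ E : Set Ω, MeasurableSet E ∧ 1 - δ ≤ P.real E ∧ ∀ ω ∈ E,
              LQ.frobNorm (H - LQ.lstd K M N W (y ω) τ)
                ≤ Bd (LQ.lstd K M N W (y ω) τ)) := by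
  refine ⟨1, 10, fun n d A B K M N W Sigma0 SigmaPi G hM hN hW hS0 hΓ hΓ0 hSPi hG => ?_⟩
  set H := LQ.valueMatrix K G with hHdef
  have hHM : (H - M).PosSemidef := LQ.valueMatrix_sub_posSemidef hΓ hM hN hG
  have hHs : Hᵀ = H := by
    have h := LQ.transpose_eq_of_posSemidef hHM
    rw [Matrix.transpose_sub, LQ.transpose_eq_of_posSemidef hM.posSemidef] at h
    exact sub_left_injective h
  have hSV : (Sigma0 + SigmaPi).PosDef := by
    have h := LQ.posSemidef_sub_of_eq_conj_add (T := (A - B * K)ᵀ) (X := SigmaPi) (Q := W)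
      hΓ.tendsto_transpose_pow hW.posSemidef (by rw [Matrix.transpose_transpose]; exact hSPi)
    have e : Sigma0 + SigmaPi = W + (Sigma0 + (SigmaPi - W)) := by abel
    rw [e]
    exact hW.add_posSemidef (hS0.add h)
  obtain ⟨i⟩ : Nonempty (Fin n) := by
    by_contra h
    rw [not_nonempty_iff] at h
    exact hΓ0 (Subsingleton.elim _ _)
  -- every matrix `X ⪰ M` has Frobenius norm at least `M i i > 0`
  have hMi : 0 < M i i := hM.diag_pos
  have hbelow : ∀ X : Matrix (Fin n) (Fin n) ℝ, (X - M).PosSemidef → M i i ≤ LQ.frobNorm X := by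
    intro X hX
    have h1 := hX.diag_nonneg (i := i)
    rw [Matrix.sub_apply] at h1
    linarith [(le_abs_self _).trans (LQ.abs_entry_le_frobNorm X i i)]
  set η := LQ.frobNorm H with hη
  have hη0 : 0 < η := hMi.trans_le (hbelow H hHM)
  have hH0 : H ≠ 0 := by
    intro h
    rw [hη, h] at hη0
    simp [LQ.frobNorm] at hη0
  obtain ⟨a, ha, hBd⟩ := LQ.exists_errorBound_eq (W := W) hM hH0 hΓ0 hSV
  obtain ⟨c, hc, hcW⟩ := LQ.exists_frobNorm_le_mul hW
  obtain ⟨D, hD, hcore⟩ := LQ.exists_lstd_bound.{u} (Sigma0 := Sigma0) hΓ hW hHs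
    (LQ.valueMatrix_eq hG)
  set D' := D * (1 + 2 / η) with hD'
  have hD'0 : 0 < D' := by positivity
  obtain ⟨τ₀, hτ₀4, hthr⟩ := LQ.exists_threshold D'
    (max 1 (max (2 * c * D / (a * η)) (D' * c * (η / M i i + 1) / a))) hD'0
  refine ⟨τ₀, ?_⟩
  intro Ω _ P _ x0 w hlaw0 hlaw hi h0 s τ δ hδ0 hδ1 hτ
  dsimp only
  have hτ4 : (4 : ℝ) ≤ τ := hτ₀4.trans hτ
  have hτ0 : (0 : ℝ) < τ := by linarith
  have hsτ : 0 < √(τ : ℝ) := Real.sqrt_pos.2 hτ0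
  obtain ⟨hLbig, hLsmall⟩ := hthr τ δ hδ0 hδ1 hτ
  simp only [hBd, one_mul]
  set L := Real.log (τ / δ) with hL
  have hL1 : 1 ≤ L := (le_max_left _ _).trans hLbig
  have hL2 : 2 * c * D / (a * η) ≤ L :=
    ((le_max_left _ _).trans (le_max_right _ _)).trans hLbig
  have hL3 : D' * c * (η / M i i + 1) / a ≤ L :=
    ((le_max_right _ _).trans (le_max_right _ _)).trans hLbig
  have hL5 : L ≤ L ^ 5 := le_self_pow₀ hL1 (by norm_num)
  have hL0 : 0 < L := by linarith
  have hbound : ∀ X : Matrix (Fin n) (Fin n) ℝ,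
      a * (L ^ 10 / √τ * (LQ.frobNorm X / c)) ≤ a * (L ^ 10 / √τ * LQ.frobNorm (W * X)) := by
    intro X
    gcongr
    rw [div_le_iff₀ hc, mul_comm]
    exact hcW X
  -- an error of size `D L ^ 5 / √τ` is at most `‖H‖ / 2`, so that `‖X‖ ≥ ‖H‖ / 2`, and the
  -- remaining factor `L ^ 5` of the bound absorbs all constants
  have hgood : D' * L ^ 5 ≤ √τ → ∀ X : Matrix (Fin n) (Fin n) ℝ,
      LQ.frobNorm (H - X) ≤ D * (L ^ 5 / √τ) →
      LQ.frobNorm (H - X) ≤ a * (L ^ 10 / √τ * LQ.frobNorm (W * X)) := by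
    intro hsm X hX
    refine hX.trans (le_trans ?_ (hbound X))
    have h1 : D * (L ^ 5 / √τ) ≤ η / 2 := by
      rw [← mul_div_assoc, div_le_div_iff₀ hsτ two_pos]
      have h2 : D * L ^ 5 * 2 / η ≤ √τ := by
        refine le_trans ?_ hsm
        rw [hD', div_le_iff₀ hη0]
        have e : D * (1 + 2 / η) * L ^ 5 * η = D * L ^ 5 * η + D * L ^ 5 * 2 := by
          field_simp
        rw [e]
        have : 0 ≤ D * L ^ 5 * η := by positivity
        linarith
      rw [div_le_iff₀ hη0] at h2
      linarith
    have h3 := LQ.frobNorm_le_sub_add H X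
    have h4 : η / 2 ≤ LQ.frobNorm X := by linarith
    have h5 : 2 * c * D ≤ L ^ 5 * (a * η) := by
      rw [div_le_iff₀ (by positivity)] at hL2
      exact hL2.trans (by gcongr)
    calc D * (L ^ 5 / √τ) = 2 * c * D * (L ^ 5 / √τ / (2 * c)) := by field_simp
      _ ≤ L ^ 5 * (a * η) * (L ^ 5 / √τ / (2 * c)) := by gcongr
      _ = a * (L ^ 10 / √τ * (η / 2 / c)) := by field_simp
      _ ≤ _ := by gcongr
  set y : Ω → ℕ → Fin n → ℝ :=
    fun ω t => LQ.lqState A B K (x0 ω) (fun t => w t ω) (s + t) with hy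
  have hcore' : D' * L ^ 5 ≤ √τ → ∃ E : Set Ω, MeasurableSet E ∧ 1 - δ ≤ P.real E ∧
      ∀ ω ∈ E, LQ.frobNorm (H - LQ.lstd K M N W (y ω) τ) ≤ D * (L ^ 5 / √τ) := by
    intro hsm
    refine hcore Ω P x0 w hlaw0 hlaw hi h0 s τ δ (by exact_mod_cast hτ4) hδ0 hδ1 (le_trans ?_ hsm)
    rw [hD']
    gcongr
    have : 0 ≤ 2 / η := by positivity
    nlinarith
  constructor
  · rcases le_or_gt (D' * L ^ 5) (√τ) with hsm | hlg
    · obtain ⟨E, hE, hPE, hb⟩ := hcore' hsm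
      refine ⟨E, hE, hPE, fun ω hω => hgood hsm _ ?_⟩
      exact (LQ.frobNorm_sub_le_of_isNearestAbove (LQ.projAbove_spec _ _) hHM).trans (hb ω hω)
    · -- here `δ` is so small that the bound exceeds the trivial one
      refine ⟨Set.univ, MeasurableSet.univ, by rw [probReal_univ]; linarith, fun ω _ => ?_⟩
      set X := LQ.lstdProj K M N W (y ω) τ with hX
      refine le_trans ?_ (hbound X)
      have hXM : M i i ≤ LQ.frobNorm X := hbelow X (LQ.projAbove_spec _ _).1
      have h1 : LQ.frobNorm (H - X) ≤ (η / M i i + 1) * LQ.frobNorm X := by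
        refine (LQ.frobNorm_sub_le H X).trans ?_
        rw [add_mul, one_mul]
        gcongr
        rw [div_mul_eq_mul_div, le_div_iff₀ hMi]
        exact mul_le_mul_of_nonneg_left hXM hη0.le
      refine h1.trans ?_
      have hX0 := LQ.frobNorm_nonneg X
      have h2 : D' * c * (η / M i i + 1) ≤ L ^ 5 * a := by
        rw [div_le_iff₀ ha] at hL3
        exact hL3.trans (by gcongr)
      have h3 : D' ≤ D' * (D' * L ^ 5 / √τ) :=
        le_mul_of_one_le_right hD'0.le ((one_le_div hsτ).2 hlg.le)
      calc (η / M i i + 1) * LQ.frobNorm X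
          = D' * c * (η / M i i + 1) * (LQ.frobNorm X / (D' * c)) := by field_simp
        _ ≤ L ^ 5 * a * (LQ.frobNorm X / (D' * c)) := by gcongr
        _ = L ^ 5 * a * (LQ.frobNorm X / c) / D' ^ 2 * D' := by field_simp
        _ ≤ L ^ 5 * a * (LQ.frobNorm X / c) / D' ^ 2 * (D' * (D' * L ^ 5 / √τ)) := by
            gcongr
        _ = a * (L ^ 10 / √τ * (LQ.frobNorm X / c)) := by field_simp
  · intro hτδ
    obtain ⟨E, hE, hPE, hb⟩ := hcore' (hLsmall hτδ)
    exact ⟨E, hE, hPE, fun ω hω => hgood (hLsmall hτδ) _ (hb ω hω)⟩
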